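/- Let $k>0$ and let $\Lambda=(\lambda_{ij})\in\mathbb R^{N\times N}$, $\Lambda\neq 0$, be a Metzler matrix ($\lambda_{ij}\ge 0$ for $i\ne j$) with spectrum in $\{z\in\mathbb C: \operatorname{Re} z\le 0\}$, for which the eigenvalue $0$ has algebraic and geometric multiplicity $k$, and which is conservative, i.e. $\Lambda^T\mathbf 1=0$. Write $y'=\Lambda y$ as the production-destruction system with $p_{k\nu}(y)=d_{\nu k}(y)=\lambda_{k\nu}y_\nu$ for $k\ne\nu$ and $p_{kk}=d_{kk}=0$. For $\alpha\ge\frac12$ and $\Delta t>0$, one step $y^n\mapsto y^{n+1}$ of the MPRK22($\alpha$) scheme from $y^n>0$ is given, for $k=1,\dots,N$, by $$y^{(2)}_k=y^n_k+\alpha\Delta t\sum_{\nu=1}^N\Bigl(p_{k\nu}(y^n)\frac{y^{(2)}_\nu}{y^n_\nu}-d_{k\nu}(y^n)\frac{y^{(2)}_k}{y^n_k}\Bigr),$$ $$y^{n+1}_k=y^n_k+\Delta t\sum_{\nu=1}^N\Bigl(P_{k\nu}\frac{y^{n+1}_\nu}{\sigma_\nu}-D_{k\nu}\frac{y^{n+1}_k}{\sigma_k}\Bigr),\qquad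 \sigma_\nu=(y^{(2)}_\nu)^{1/\alpha}(y^n_\nu)^{1-1/\alpha},$$ where $P_{k\nu}=(1-\frac1{2\alpha})p_{k\nu}(y^n)+\frac1{2\alpha}p_{k\nu}(y^{(2)})$ and $D_{k\nu}=(1-\frac1{2\alpha})d_{k\nu}(y^n)+\frac1{2\alpha}d_{k\nu}(y^{(2)})$. 1. (Unconditional stability.) For every $\alpha\ge\frac12$, $\Delta t>0$ and $y^n>0$ these equations have exactly one solution $(y^{(2)},y^{n+1})$, and it is positive. Moreover MPRK22($\alpha$) is unconditionally stable: for arbitrarily large $c>0$, every positive steady state $y^*\in\ker\Lambda\cap\mathbb R^N_{>0}$ is a Lyapunov stable fixed point of $y^n\mapsto y^{n+1}$ on $\mathbb R^N_{>0}$ for all $0<\Delta t<c$. 2. (Local convergence.) Let $y^*\in\ker\Lambda\cap\mathbb R^N_{>0}$. There is a $\delta>0$ such that for every $y^0>0$ for which $y^*$ is the steady state of the initial value problem $y'=\Lambda y$, $y(0)=y^0$ (i.e. $v^Ty^*=v^Ty^0$ for all $v\in\ker\Lambda^T$) and $\|y^0-y^*\|<\delta$, the iterates $y^n$ of MPRK22($\alpha$)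 started at $y^0$ converge to $y^*$ as $n\to\infty$, for all $\Delta t>0$ and all $\alpha\ge\frac12$. 3. (Stability function.) The function $R(z)=\dfrac{-z^2-2\alpha z+2}{2(1-\alpha z)(1-z)}$ satisfies $R(0)=1$ for $\alpha\ge\frac12$. For $\alpha>\frac12$, $|R(z)|<1$ for all $z\ne0$ with $\operatorname{Re}z\le0$. For $\alpha=\frac12$, $|R(z)|<1$ if $\operatorname{Re}z<0$ and $|R(z)|=1$ if $\operatorname{Re}z=0$. -/

import Mathlib

open Matrix Filter Topology

noncomputable section

/-- The open positive orthant of `ℝ^N`. -/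
def positiveOrthant (N : ℕ) : Set (Fin N → ℝ) := {y | ∀ i, 0 < y i}

/-- The class of linear test systems `y' = Λ y` with `Λ ≠ 0`: `Λ` is a Metzler matrix with spectrum
in the closed left half-plane, and the eigenvalue `0` has algebraic and geometric multiplicity `k`
(that is, there are `k` linear invariants). -/
structure IsPositiveLinearSystem {N : ℕ} (Λ : Matrix (Fin N) (Fin N) ℝ) (k : ℕ) : Prop where
  ne_zero : Λ ≠ 0
  metzler : ∀ i j, i ≠ j → 0 ≤ Λ i j
  spectrum_le : ∀ z ∈ spectrum ℂ (Λ.map (algebraMap ℝ ℂ)), z.re ≤ 0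
  algebraic_mult : Λ.charpoly.rootMultiplicity 0 = k
  geometric_mult : Module.finrank ℝ (LinearMap.ker Λ.mulVecLin) = k

/-- The system is conservative: the all-ones vector lies in the kernel of `Λᵀ`. -/
def IsConservative {N : ℕ} (Λ : Matrix (Fin N) (Fin N) ℝ) : Prop :=
  Λᵀ *ᵥ (fun _ => (1 : ℝ)) = 0

/-- `ystar` is the steady state of the initial value problem `y' = Λ y`, `y(0) = y0`: it lies in
the kernel of `Λ` and every linear invariant of the system has the same value at `ystar` as at
`y0`. -/
structure IsSteadyStateOfIVP {N : ℕ} (Λ : Matrix (Fin N) (Fin N) ℝ) (y0 ystar : Fin N → ℝ) :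
    Prop where
  steady : Λ *ᵥ ystar = 0
  invariants : ∀ v : Fin N → ℝ, Λᵀ *ᵥ v = 0 → v ⬝ᵥ ystar = v ⬝ᵥ y0

/-- The second stage of the MPRK22(`α`) scheme with step size `Δt` for the autonomous
production-destruction system `y_k' = ∑ ν, (p k ν y - d k ν y)`. -/
def MPRK22Stage {N : ℕ} (p d : Fin N → Fin N → (Fin N → ℝ) → ℝ) (α Δt : ℝ)
    (y y2 : Fin N → ℝ) : Prop :=
  ∀ k, y2 k = y k + α * Δt * ∑ ν, (p k ν y * (y2 ν / y ν) - d k ν y * (y2 k / y k))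

/-- The update of the MPRK22(`α`) scheme. -/
def MPRK22Update {N : ℕ} (p d : Fin N → Fin N → (Fin N → ℝ) → ℝ) (α Δt : ℝ)
    (y y2 y1 : Fin N → ℝ) : Prop :=
  ∀ k, y1 k = y k + Δt * ∑ ν,
    (((1 - 1 / (2 * α)) * p k ν y + 1 / (2 * α) * p k ν y2)
        * (y1 ν / (y2 ν ^ (1 / α) * y ν ^ (1 - 1 / α)))
      - ((1 - 1 / (2 * α)) * d k ν y + 1 / (2 * α) * d k ν y2)
        * (y1 k / (y2 k ^ (1 / α) * y k ^ (1 - 1 / α))))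

/-- Production terms of a linear conservative system `y' = Λ y`. -/
def linearProduction {N : ℕ} (Λ : Matrix (Fin N) (Fin N) ℝ) (k ν : Fin N) (y : Fin N → ℝ) : ℝ :=
  if k = ν then 0 else Λ k ν * y ν

/-- Destruction terms of a linear conservative system `y' = Λ y`. -/
def linearDestruction {N : ℕ} (Λ : Matrix (Fin N) (Fin N) ℝ) (k ν : Fin N) (y : Fin N → ℝ) : ℝ :=
  linearProduction Λ ν k y

/-- `y2` and `y1` solve the equations of one MPRK22(`α`) step for `y' = Λ y` started at `y`. -/
def IsMPRK22Step {N : ℕ} (Λ : Matrix (Fin N) (Fin N) ℝ) (α Δt : ℝ) (y y2 y1 : Fin N → ℝ) : Prop :=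
  MPRK22Stage (linearProduction Λ) (linearDestruction Λ) α Δt y y2 ∧
    MPRK22Update (linearProduction Λ) (linearDestruction Λ) α Δt y y2 y1

/-- The generating map `y^n ↦ y^{n+1}` of MPRK22(`α`) for `y' = Λ y`: the solution `y1` of the
implicit equations of a step (their unique solvability is part of the claim). -/
def mprk22Map {N : ℕ} (Λ : Matrix (Fin N) (Fin N) ℝ) (α Δt : ℝ) (y : Fin N → ℝ) : Fin N → ℝ :=
  Classical.epsilon fun y1 => ∃ y2, IsMPRK22Step Λ α Δt y y2 y1

/-- `x` is a Lyapunov stable fixed point of the iteration of `g` on the domain `D`. (All norms on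
`ℝ^N` are equivalent, so the choice of the norm does not matter.) -/
def IsLyapunovStableFixedPoint {N : ℕ} (D : Set (Fin N → ℝ)) (g : (Fin N → ℝ) → (Fin N → ℝ))
    (x : Fin N → ℝ) : Prop :=
  g x = x ∧ ∀ ε > 0, ∃ δ > 0, ∀ y0 ∈ D, ‖y0 - x‖ < δ → ∀ n : ℕ, ‖g^[n] y0 - x‖ < ε

/-- For all step sizes `0 < Δt < c`, every positive steady state of `y' = Λ y` is a Lyapunov stable
fixed point of the one-step method with generating maps `g Δt`. -/
def IsStableBelow {N : ℕ} (Λ : Matrix (Fin N) (Fin N) ℝ)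
    (g : ℝ → (Fin N → ℝ) → (Fin N → ℝ)) (c : ℝ) : Prop :=
  ∀ Δt, 0 < Δt → Δt < c → ∀ ystar ∈ positiveOrthant N, Λ *ᵥ ystar = 0 →
    IsLyapunovStableFixedPoint (positiveOrthant N) (g Δt) ystar

/-- The one-step method is conditionally stable and the bound `c` on the step size can be chosen
arbitrarily large. -/
def IsUnconditionallyStable {N : ℕ} (Λ : Matrix (Fin N) (Fin N) ℝ)
    (g : ℝ → (Fin N → ℝ) → (Fin N → ℝ)) : Prop :=
  ∀ C > 0, ∃ c > C, IsStableBelow Λ g c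

/-- The stability function of MPRK22(`α`). -/
def mprk22StabilityFunction (α : ℝ) (z : ℂ) : ℂ :=
  (-z ^ 2 - 2 * α * z + 2) / (2 * (1 - α * z) * (1 - z))

end

/-! Stability and convergence come from an explicit Lyapunov function, not from the eigenvalues of a
Jacobian. Fix a positive steady state `p` and put `x = y / p`. The matrix `B = scaledGenerator Λ p`
has zero row sums because `Λ p = 0`, and `p` is stationary for it because `Λ` is conservative. The
step becomes `x2 = x + α T B x2`, `x1 = x + T B v`, `v = w x1`, with `w` the Patankar weights. Total
mass is preserved, so `chiSqDist p` differs from `∑ p_i / x_i` only by a constant, and it suffices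
that this sum decreases (`exists_decay`).

Since `x x1 = v (x / w)`, the increment of `1 / x` is `-(T B v) / (v (x / w))`. To leading order `v`
is the solution `V` of a linear equation and `x / w` is `V + (α - 1/2) b`, with `b` from
`exists_linear_stage`. Two negative terms appear: the entropy dissipation of `1 / s` along `B` at
`V`, of order `M² / T` with `M = T ‖B V‖`, and `-(α - 1/2) (α + 1/2) ∑ p_i b_i²`, from the quadratic
form of `B`.

The errors must be absorbed uniformly in `T` and `α`. Two of them are pointwise only `O(δ M²)`, too
large for big `T`; but sums `∑ p_i (B u)_i g_i` see only the variation of `g` inside communicating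
classes (`abs_sum_mulVec_mul_le`), which is of order `M / T` times the size of the error. The others
carry a factor `α - 1/2` or `1 - 1/(2α)` and are handled by `remainder_le_dissipation`, using for
large `T` that `0` is a semisimple eigenvalue of `B`.

Small sublevel sets are therefore invariant, which gives stability. The summable decrements force `B
(y^n / p) → 0`, and on states with the invariants of `p` this means `y^n → p`. Solvability and
positivity of a step are inverse positivity of `diag d - T Λ`. The claims on `R` follow from one
identity for `|denominator|² - |numerator|²`. -/

/-! ### Linear algebra in finite dimension -/

/-- A linear map that vanishes on the kernel of `f` is bounded by a multiple of `‖f x‖`. -/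
theorem exists_norm_le_of_ker_le {E F G : Type*} [AddCommGroup E] [Module ℝ E]
    [NormedAddCommGroup F] [NormedSpace ℝ F] [FiniteDimensional ℝ F]
    [NormedAddCommGroup G] [NormedSpace ℝ G] (f : E →ₗ[ℝ] F) (g : E →ₗ[ℝ] G)
    (h : LinearMap.ker f ≤ LinearMap.ker g) : ∃ C > 0, ∀ x, ‖g x‖ ≤ C * ‖f x‖ := by
  -- `f` is injective on the quotient by its kernel, and `g` factors through that quotient. Hence
  -- `g` is a linear function of `f x`, continuous because `F` is finite dimensional.
  obtain ⟨k, hk⟩ := LinearMap.exists_leftInverse_of_injective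
    ((LinearMap.ker f).liftQ f le_rfl) (Submodule.ker_liftQ_eq_bot _ _ _ le_rfl)
  let m : F →L[ℝ] G := LinearMap.toContinuousLinearMap (((LinearMap.ker f).liftQ g h) ∘ₗ k)
  refine ⟨‖m‖ + 1, by positivity, fun x => ?_⟩
  have hx : m (f x) = g x := by
    have := LinearMap.congr_fun hk ((LinearMap.ker f).mkQ x)
    simp only [LinearMap.coe_comp, Function.comp_apply, Submodule.mkQ_apply, Submodule.liftQ_apply,
      LinearMap.id_apply] at this
    simp [m, this]
  rw [← hx]
  exact (m.le_opNorm _).trans (by gcongr; linarith)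

/-- The components of `M *ᵥ u` for a matrix with zero column sums, written with the off-diagonal
entries only. -/
theorem sum_offDiag_sub_eq_mulVec {N : ℕ} {Λ : Matrix (Fin N) (Fin N) ℝ}
    (hcol : ∀ j, ∑ i, Λ i j = 0) (g : Fin N → ℝ) (k : Fin N) :
    ∑ ν, ((if k = ν then 0 else Λ k ν * g ν) - (if ν = k then 0 else Λ ν k * g k))
      = (Λ *ᵥ g) k := by
  have h : ∀ ν, ((if k = ν then 0 else Λ k ν * g ν) - (if ν = k then 0 else Λ ν k * g k))
      = Λ k ν * g ν - Λ ν k * g k := by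
    intro ν
    by_cases hk : k = ν
    · subst hk; simp
    · rw [if_neg hk, if_neg (Ne.symm hk)]
  simp only [h, Finset.sum_sub_distrib, ← Finset.sum_mul, hcol, zero_mul, sub_zero]
  rfl

theorem IsConservative.sum_col {N : ℕ} {Λ : Matrix (Fin N) (Fin N) ℝ} (h : IsConservative Λ)
    (j : Fin N) : ∑ i, Λ i j = 0 := by
  have := congrFun h j
  simpa [Matrix.mulVec, dotProduct] using this

/-- Inverse positivity of `diag d - T Λ` for a conservative Metzler matrix `Λ`. -/
theorem nonneg_of_metzler_col {N : ℕ} {Λ : Matrix (Fin N) (Fin N) ℝ}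
    (hoff : ∀ i j, i ≠ j → 0 ≤ Λ i j) (hcol : ∀ j, ∑ i, Λ i j = 0) {T : ℝ} (hT : 0 ≤ T)
    {d u f : Fin N → ℝ} (hd : ∀ i, 0 < d i) (hf : ∀ i, 0 ≤ f i)
    (h : ∀ i, d i * u i = f i + T * (Λ *ᵥ u) i) : ∀ i, 0 ≤ u i := by
  -- The equation is tested with the indicator of the negative set. Zero column sums allow replacing
  -- `s i` by `s i - s j`, and `u j * (s i - s j)` is never negative.
  let s : Fin N → ℝ := fun i => if u i < 0 then 1 else 0
  have hs : ∀ i, 0 ≤ s i := fun i => by simp only [s]; split_ifs <;> norm_num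
  have h1 : 0 ≤ ∑ i, s i * (Λ *ᵥ u) i := by
    have : ∑ i, s i * (Λ *ᵥ u) i = ∑ j, ∑ i, Λ i j * (u j * (s i - s j)) := by
      have e1 : ∀ j, ∑ i, Λ i j * (u j * (s i - s j)) = ∑ i, s i * (Λ i j * u j) := by
        intro j
        have : ∑ i, Λ i j * (u j * (s i - s j))
            = ∑ i, s i * (Λ i j * u j) - (∑ i, Λ i j) * (u j * s j) := by
          rw [Finset.sum_mul, ← Finset.sum_sub_distrib]
          exact Finset.sum_congr rfl fun i _ => by ring
        rw [this, hcol, zero_mul, sub_zero]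
      simp only [e1]
      rw [Finset.sum_comm]
      simp [Matrix.mulVec, dotProduct, Finset.mul_sum]
    rw [this]
    refine Finset.sum_nonneg fun j _ => Finset.sum_nonneg fun i _ => ?_
    by_cases hij : i = j
    · subst hij; simp
    · refine mul_nonneg (hoff i j hij) ?_
      simp only [s]
      split_ifs <;> nlinarith
  have h2 : 0 ≤ ∑ i, s i * (d i * u i) := by
    have : ∑ i, s i * (d i * u i) = ∑ i, s i * f i + T * ∑ i, s i * (Λ *ᵥ u) i := by
      rw [Finset.mul_sum, ← Finset.sum_add_distrib]
      exact Finset.sum_congr rfl fun i _ => by rw [h i]; ring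
    rw [this]
    exact add_nonneg (Finset.sum_nonneg fun i _ => mul_nonneg (hs i) (hf i)) (mul_nonneg hT h1)
  have h3 : ∀ i ∈ Finset.univ, s i * (d i * u i) ≤ 0 := by
    intro i _
    simp only [s]
    split_ifs with hi
    · rw [one_mul]; exact (mul_neg_of_pos_of_neg (hd i) hi).le
    · simp
  have h4 : ∀ i ∈ Finset.univ, s i * (d i * u i) = 0 :=
    (Finset.sum_eq_zero_iff_of_nonpos h3).1 (le_antisymm (Finset.sum_nonpos (N := ℝ) h3) h2)
  intro i
  by_contra hi
  push Not at hi
  have h5 := h4 i (Finset.mem_univ i)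
  simp only [s, if_pos hi, one_mul] at h5
  exact (mul_neg_of_pos_of_neg (hd i) hi).ne h5

theorem pos_of_metzler_col {N : ℕ} {Λ : Matrix (Fin N) (Fin N) ℝ}
    (hoff : ∀ i j, i ≠ j → 0 ≤ Λ i j) (hcol : ∀ j, ∑ i, Λ i j = 0) {T : ℝ} (hT : 0 ≤ T)
    {d u f : Fin N → ℝ} (hd : ∀ i, 0 < d i) (hf : ∀ i, 0 < f i)
    (h : ∀ i, d i * u i = f i + T * (Λ *ᵥ u) i) : ∀ i, 0 < u i := by
  have h0 := nonneg_of_metzler_col hoff hcol hT hd (fun i => (hf i).le) h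
  intro i
  rcases (h0 i).lt_or_eq with hi | hi
  · exact hi
  · exfalso
    have h1 : 0 ≤ (Λ *ᵥ u) i := by
      change 0 ≤ ∑ j, Λ i j * u j
      refine Finset.sum_nonneg fun j _ => ?_
      by_cases hij : i = j
      · subst hij; simp [← hi]
      · exact mul_nonneg (hoff i j hij) (h0 j)
    have h2 := h i
    rw [← hi] at h2
    nlinarith [hf i, mul_nonneg hT h1]

/-- A matrix equation `d u = f + T M u` is uniquely solvable if `f ≥ 0` implies `u ≥ 0`. -/
theorem existsUnique_of_inverse_nonneg {N : ℕ} {M : Matrix (Fin N) (Fin N) ℝ} {T : ℝ}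
    {d : Fin N → ℝ}
    (hpos : ∀ u f : Fin N → ℝ, (∀ i, 0 ≤ f i) → (∀ i, d i * u i = f i + T * (M *ᵥ u) i) →
      ∀ i, 0 ≤ u i) (f : Fin N → ℝ) :
    ∃! u : Fin N → ℝ, ∀ i, d i * u i = f i + T * (M *ᵥ u) i := by
  let A : (Fin N → ℝ) →ₗ[ℝ] (Fin N → ℝ) := (Matrix.diagonal d - T • M).mulVecLin
  have hA : ∀ u i, A u i = d i * u i - T * (M *ᵥ u) i := by
    intro u i
    simp [A, Matrix.mulVec_diagonal]
  have hinj : Function.Injective A := by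
    rw [← LinearMap.ker_eq_bot, LinearMap.ker_eq_bot']
    intro u hu
    have hu' : ∀ i, d i * u i = 0 + T * (M *ᵥ u) i := by
      intro i
      have := congrFun hu i
      rw [hA] at this
      simp only [Pi.zero_apply] at this
      linarith
    have h1 := hpos u 0 (fun _ => le_rfl) hu'
    have h2 := hpos (-u) 0 (fun _ => le_rfl) (fun i => by
      have := hu' i
      simp only [Matrix.mulVec_neg, Pi.neg_apply, Pi.zero_apply]
      linarith)
    ext i
    have h3 := h2 i
    simp only [Pi.neg_apply] at h3
    have h4 : u i ≤ 0 := by linarith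
    exact le_antisymm h4 (h1 i)
  obtain ⟨u, hu⟩ := (LinearMap.injective_iff_surjective.1 hinj) f
  refine ⟨u, fun i => ?_, fun u' hu' => hinj ?_⟩
  · have := congrFun hu i
    rw [hA] at this
    linarith
  · rw [hu]
    ext i
    rw [hA, hu' i]
    ring

/-! ### The equations of one step -/

/-- The Patankar weight of the update stage. -/
noncomputable def patankarWeight (α s t : ℝ) : ℝ :=
  ((1 - 1 / (2 * α)) * s + 1 / (2 * α) * t) / (t ^ (1 / α) * s ^ (1 - 1 / α))

theorem patankarWeight_pos {α s t : ℝ} (hα : 1 / 2 ≤ α) (hs : 0 < s) (ht : 0 < t) :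
    0 < patankarWeight α s t := by
  have h1 : 0 < 1 / (2 * α) := by positivity
  have h2 : 1 / (2 * α) ≤ 1 := by
    rw [div_le_one (by linarith)]; linarith
  have h3 : 0 ≤ (1 - 1 / (2 * α)) * s := mul_nonneg (by linarith) hs.le
  exact div_pos (by nlinarith [mul_pos h1 ht]) (by positivity)

/-- Linearity of the production terms cancels the denominators `y ν` in the stage and collects the
update coefficients into one weight. The stage is thus linear in `y2`, and the update is linear in
`y1` once `y2` is known. -/
theorem isMPRK22Step_iff {N : ℕ} {Λ : Matrix (Fin N) (Fin N) ℝ} (hΛ : IsConservative Λ)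
    {α Δt : ℝ} {y y2 y1 : Fin N → ℝ} (hy : y ∈ positiveOrthant N) :
    IsMPRK22Step Λ α Δt y y2 y1 ↔
      (∀ k, y2 k = y k + α * Δt * (Λ *ᵥ y2) k) ∧
      (∀ k, y1 k = y k
        + Δt * (Λ *ᵥ (fun ν => patankarWeight α (y ν) (y2 ν) * y1 ν)) k) := by
  unfold IsMPRK22Step MPRK22Stage MPRK22Update
  refine and_congr (forall_congr' fun k => ?_) (forall_congr' fun k => ?_)
  · rw [← sum_offDiag_sub_eq_mulVec hΛ.sum_col]
    have : ∀ ν, linearProduction Λ k ν y * (y2 ν / y ν)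
          - linearDestruction Λ k ν y * (y2 k / y k)
        = (if k = ν then 0 else Λ k ν * y2 ν) - (if ν = k then 0 else Λ ν k * y2 k) := by
      intro ν
      have h1 := (hy ν).ne'
      have h2 := (hy k).ne'
      unfold linearDestruction linearProduction
      split_ifs <;> field_simp <;> ring
    simp only [this]
  · rw [← sum_offDiag_sub_eq_mulVec hΛ.sum_col]
    have : ∀ ν, ((1 - 1 / (2 * α)) * linearProduction Λ k ν y
            + 1 / (2 * α) * linearProduction Λ k ν y2)
          * (y1 ν / (y2 ν ^ (1 / α) * y ν ^ (1 - 1 / α)))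
        - ((1 - 1 / (2 * α)) * linearDestruction Λ k ν y
            + 1 / (2 * α) * linearDestruction Λ k ν y2)
          * (y1 k / (y2 k ^ (1 / α) * y k ^ (1 - 1 / α)))
        = (if k = ν then 0 else Λ k ν * (patankarWeight α (y ν) (y2 ν) * y1 ν))
          - (if ν = k then 0 else Λ ν k * (patankarWeight α (y k) (y2 k) * y1 k)) := by
      intro ν
      unfold linearDestruction linearProduction patankarWeight
      split_ifs <;> ring
    simp only [this]

theorem step_existsUnique_pos {N : ℕ} {Λ : Matrix (Fin N) (Fin N) ℝ}
    (hoff : ∀ i j, i ≠ j → 0 ≤ Λ i j) (hΛ : IsConservative Λ) {α Δt : ℝ} (hα : 1 / 2 ≤ α)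
    (hΔt : 0 < Δt) {y : Fin N → ℝ} (hy : y ∈ positiveOrthant N) :
    (∃! x : (Fin N → ℝ) × (Fin N → ℝ), IsMPRK22Step Λ α Δt y x.1 x.2) ∧
      ∀ y2 y1, IsMPRK22Step Λ α Δt y y2 y1 →
        y2 ∈ positiveOrthant N ∧ y1 ∈ positiveOrthant N := by
  have hα0 : 0 < α := by linarith
  have hαt : 0 ≤ α * Δt := by positivity
  -- the stage is a linear system
  have hstage_pos : ∀ y2 : Fin N → ℝ, (∀ k, y2 k = y k + α * Δt * (Λ *ᵥ y2) k) →
      ∀ i, 0 < y2 i := fun y2 h2 =>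
    pos_of_metzler_col hoff hΛ.sum_col hαt (d := fun _ => 1) (fun _ => one_pos) hy
      (fun i => by rw [one_mul]; exact h2 i)
  obtain ⟨y2, hy2, hy2u⟩ := existsUnique_of_inverse_nonneg (M := Λ) (T := α * Δt)
    (d := fun _ => 1) (fun u f hf h => nonneg_of_metzler_col hoff hΛ.sum_col hαt
      (fun _ => one_pos) hf h) y
  simp only [one_mul] at hy2 hy2u
  have hupd : ∀ (y2 y1 : Fin N → ℝ), (∀ i, 0 < y2 i) →
      (∀ k, y1 k = y k
        + Δt * (Λ *ᵥ (fun ν => patankarWeight α (y ν) (y2 ν) * y1 ν)) k) →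
      ∀ i, (patankarWeight α (y i) (y2 i))⁻¹ * (patankarWeight α (y i) (y2 i) * y1 i)
        = y i + Δt * (Λ *ᵥ (fun ν => patankarWeight α (y ν) (y2 ν) * y1 ν)) i := by
    intro y2 y1 hpos h i
    rw [← h i, ← mul_assoc, inv_mul_cancel₀ (patankarWeight_pos hα (hy i) (hpos i)).ne', one_mul]
  have hwpos : ∀ (y2 : Fin N → ℝ), (∀ i, 0 < y2 i) →
      ∀ i, 0 < (patankarWeight α (y i) (y2 i))⁻¹ :=
    fun y2 hpos i => inv_pos.2 (patankarWeight_pos hα (hy i) (hpos i))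
  constructor
  · have hpos := hstage_pos y2 hy2
    -- In the unknown `v = w * y1` the weights move to the diagonal: `w⁻¹ v = y + Δt Λ v`.
    obtain ⟨v, hv, hvu⟩ := existsUnique_of_inverse_nonneg (M := Λ) (T := Δt)
      (d := fun i => (patankarWeight α (y i) (y2 i))⁻¹)
      (fun u f hf h => nonneg_of_metzler_col hoff hΛ.sum_col hΔt.le (hwpos y2 hpos) hf h) y
    have hw : ∀ i, patankarWeight α (y i) (y2 i) ≠ 0 := fun i =>
      (patankarWeight_pos hα (hy i) (hpos i)).ne'
    refine ⟨(y2, fun i => (patankarWeight α (y i) (y2 i))⁻¹ * v i), ?_, ?_⟩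
    · simp only
      rw [isMPRK22Step_iff hΛ hy]
      refine ⟨hy2, fun k => ?_⟩
      have : (fun ν => patankarWeight α (y ν) (y2 ν)
          * ((patankarWeight α (y ν) (y2 ν))⁻¹ * v ν)) = v := by
        ext ν
        rw [← mul_assoc, mul_inv_cancel₀ (hw ν), one_mul]
      simp only [this]
      exact hv k
    · rintro ⟨z2, z1⟩ hz
      rw [isMPRK22Step_iff hΛ hy] at hz
      obtain ⟨hz2, hz1⟩ := hz
      have h2 : z2 = y2 := hy2u z2 hz2
      subst h2
      have h1 := hvu _ (hupd z2 z1 hpos hz1)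
      refine Prod.ext rfl (funext fun i => ?_)
      rw [← h1]
      simp only
      rw [← mul_assoc, inv_mul_cancel₀ (hw i), one_mul]
  · intro z2 z1 hz
    rw [isMPRK22Step_iff hΛ hy] at hz
    obtain ⟨hz2, hz1⟩ := hz
    have hpos := hstage_pos z2 hz2
    refine ⟨hpos, fun i => ?_⟩
    have := pos_of_metzler_col hoff hΛ.sum_col hΔt.le (hwpos z2 hpos) hy (hupd z2 z1 hpos hz1) i
    exact pos_of_mul_pos_right this (patankarWeight_pos hα (hy i) (hpos i)).le

theorem isMPRK22Step_mprk22Map {N : ℕ} {Λ : Matrix (Fin N) (Fin N) ℝ}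
    (hoff : ∀ i j, i ≠ j → 0 ≤ Λ i j) (hΛ : IsConservative Λ) {α Δt : ℝ} (hα : 1 / 2 ≤ α)
    (hΔt : 0 < Δt) {y : Fin N → ℝ} (hy : y ∈ positiveOrthant N) :
    ∃ y2, IsMPRK22Step Λ α Δt y y2 (mprk22Map Λ α Δt y) := by
  obtain ⟨⟨x, hx, -⟩, -⟩ := step_existsUnique_pos hoff hΛ hα hΔt hy
  exact Classical.epsilon_spec (p := fun y1 => ∃ y2, IsMPRK22Step Λ α Δt y y2 y1) ⟨x.2, x.1, hx⟩

/-! ### The stability function -/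

/-- For `Re z ≤ 0` and `α ≥ 1/2` every term of the difference is nonnegative. The last one is
positive for `α > 1/2` and `z ≠ 0`; at `α = 1/2` only the first survives, and it vanishes on the
imaginary axis. -/
theorem normSq_denominator_sub_normSq_numerator (α : ℝ) (z : ℂ) :
    Complex.normSq (2 * (1 - α * z) * (1 - z))
      = Complex.normSq (-z ^ 2 - 2 * α * z + 2)
        + (8 * (-z.re) * Complex.normSq (1 - ((α + 1 / 2 : ℝ) : ℂ) * z)
          + 2 * (2 * α - 1) * (-z.re) * Complex.normSq z
          + (4 * α ^ 2 - 1) * Complex.normSq z ^ 2) := by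
  simp [Complex.normSq_apply, pow_two]
  ring

theorem norm_div_lt_one_of_normSq_lt {a b : ℂ} (h : Complex.normSq a < Complex.normSq b) :
    ‖a / b‖ < 1 := by
  have hb : 0 < Complex.normSq b := (Complex.normSq_nonneg a).trans_lt h
  rw [Complex.normSq_eq_norm_sq, Complex.normSq_eq_norm_sq] at h
  have hb' : 0 < ‖b‖ := norm_pos_iff.2 (Complex.normSq_pos.1 hb)
  rw [norm_div, div_lt_one hb']
  exact lt_of_pow_lt_pow_left₀ 2 hb'.le h

theorem mprk22StabilityFunction_zero (α : ℝ) : mprk22StabilityFunction α 0 = 1 := by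
  simp [mprk22StabilityFunction]

theorem norm_mprk22StabilityFunction_lt_one {α : ℝ} (hα : 1 / 2 < α) {z : ℂ} (hz : z.re ≤ 0)
    (hz0 : z ≠ 0) : ‖mprk22StabilityFunction α z‖ < 1 := by
  refine norm_div_lt_one_of_normSq_lt ?_
  rw [normSq_denominator_sub_normSq_numerator]
  have h1 := Complex.normSq_pos.2 hz0
  have h2 := Complex.normSq_nonneg (1 - ((α + 1 / 2 : ℝ) : ℂ) * z)
  have h3 : 0 ≤ 8 * (-z.re) * Complex.normSq (1 - ((α + 1 / 2 : ℝ) : ℂ) * z) :=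
    mul_nonneg (by linarith) h2
  have h4 : 0 ≤ 2 * (2 * α - 1) * (-z.re) * Complex.normSq z :=
    mul_nonneg (mul_nonneg (by linarith) (by linarith)) h1.le
  have h5 : 0 < (4 * α ^ 2 - 1) * Complex.normSq z ^ 2 :=
    mul_pos (by nlinarith) (by positivity)
  linarith

theorem norm_mprk22StabilityFunction_half_lt_one {z : ℂ} (hz : z.re < 0) :
    ‖mprk22StabilityFunction (1 / 2) z‖ < 1 := by
  refine norm_div_lt_one_of_normSq_lt ?_
  rw [normSq_denominator_sub_normSq_numerator]
  have h2 : 0 < Complex.normSq (1 - ((1 / 2 + 1 / 2 : ℝ) : ℂ) * z) := by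
    refine Complex.normSq_pos.2 fun h => ?_
    have := congrArg Complex.re h
    norm_num at this
    linarith
  have h3 : 0 < 8 * (-z.re) * Complex.normSq (1 - ((1 / 2 + 1 / 2 : ℝ) : ℂ) * z) :=
    mul_pos (by linarith) h2
  norm_num at h3 ⊢
  linarith

theorem norm_mprk22StabilityFunction_half_eq_one {z : ℂ} (hz : z.re = 0) :
    ‖mprk22StabilityFunction (1 / 2) z‖ = 1 := by
  have h := normSq_denominator_sub_normSq_numerator (1 / 2) z
  rw [hz] at h
  norm_num at h
  have h0 : (2 * (1 - ((1 / 2 : ℝ) : ℂ) * z) * (1 - z)) ≠ 0 := by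
    refine mul_ne_zero (mul_ne_zero two_ne_zero fun h => ?_) fun h => ?_
    · have := congrArg Complex.re h
      norm_num [hz] at this
    · have := congrArg Complex.re h
      norm_num [hz] at this
  unfold mprk22StabilityFunction
  rw [norm_div, div_eq_one_iff_eq (norm_ne_zero_iff.2 h0)]
  refine (pow_left_inj₀ (norm_nonneg _) (norm_nonneg _) two_ne_zero).1 ?_
  rw [← Complex.normSq_eq_norm_sq, ← Complex.normSq_eq_norm_sq]
  norm_num
  exact h.symm

/-! ### Generators of Markov chains with a positive stationary measure -/

/-- `B` is the generator of a continuous-time Markov chain, with positive stationary measure `p`. -/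
structure IsStationaryGenerator {N : ℕ} (B : Matrix (Fin N) (Fin N) ℝ) (p : Fin N → ℝ) : Prop where
  pos : ∀ i, 0 < p i
  offDiag : ∀ i j, i ≠ j → 0 ≤ B i j
  row_sum : ∀ i, ∑ j, B i j = 0
  stationary : ∀ j, ∑ i, p i * B i j = 0

/-- The quadratic form `∑ i j, p i * B i j * (u j - u i) ^ 2`. -/
def dirichletSum {N : ℕ} (B : Matrix (Fin N) (Fin N) ℝ) (p u : Fin N → ℝ) : ℝ :=
  ∑ i, ∑ j, p i * B i j * (u j - u i) ^ 2

/-- A representative of the communicating class of `i`. -/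
noncomputable def classRep {N : ℕ} (B : Matrix (Fin N) (Fin N) ℝ) (i : Fin N) : Fin N :=
  Quot.out (Quot.mk (fun i j => B i j ≠ 0) i)

namespace IsStationaryGenerator

variable {N : ℕ} {B : Matrix (Fin N) (Fin N) ℝ} {p : Fin N → ℝ}

theorem mulVec_apply (hB : IsStationaryGenerator B p) (u : Fin N → ℝ) (i : Fin N) :
    (B *ᵥ u) i = ∑ j, B i j * (u j - u i) := by
  simp only [mul_sub, Finset.sum_sub_distrib, ← Finset.sum_mul, hB.row_sum, zero_mul, sub_zero]
  rfl

theorem mulVec_one (hB : IsStationaryGenerator B p) : B *ᵥ 1 = 0 := by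
  ext i
  simp [hB.mulVec_apply]

theorem sum_stationary (hB : IsStationaryGenerator B p) (F : Fin N → ℝ) :
    ∑ i, ∑ j, p i * B i j * F j = 0 := by
  rw [Finset.sum_comm]
  simp only [← Finset.sum_mul, hB.stationary, zero_mul, Finset.sum_const_zero]

theorem sum_row (hB : IsStationaryGenerator B p) (F : Fin N → ℝ) :
    ∑ i, ∑ j, p i * B i j * F i = 0 := by
  simp only [← Finset.sum_mul, ← Finset.mul_sum, hB.row_sum, mul_zero, zero_mul,
    Finset.sum_const_zero]

theorem sum_mul_mulVec (u g : Fin N → ℝ) :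
    ∑ i, p i * ((B *ᵥ u) i * g i) = ∑ i, ∑ j, p i * B i j * (u j * g i) := by
  refine Finset.sum_congr rfl fun i _ => ?_
  simp only [Matrix.mulVec, dotProduct, Finset.sum_mul, Finset.mul_sum]
  exact Finset.sum_congr rfl fun j _ => by ring

theorem nonneg_of_eq (hB : IsStationaryGenerator B p) {T : ℝ} (hT : 0 ≤ T) {d u f : Fin N → ℝ}
    (hd : ∀ i, 0 < d i) (hf : ∀ i, 0 ≤ f i) (h : ∀ i, d i * u i = f i + T * (B *ᵥ u) i) :
    ∀ i, 0 ≤ u i := by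
  intro k
  obtain ⟨i, -, hi⟩ := Finset.exists_min_image Finset.univ u ⟨k, Finset.mem_univ k⟩
  refine le_trans ?_ (hi k (Finset.mem_univ k))
  have h1 : 0 ≤ (B *ᵥ u) i := by
    rw [hB.mulVec_apply]
    refine Finset.sum_nonneg fun j _ => ?_
    by_cases hij : i = j
    · subst hij; simp
    · exact mul_nonneg (hB.offDiag i j hij) (sub_nonneg.2 (hi j (Finset.mem_univ j)))
  have h2 : 0 ≤ d i * u i := by
    rw [h i]; exact add_nonneg (hf i) (mul_nonneg hT h1)
  exact nonneg_of_mul_nonneg_right h2 (hd i)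

/-- Maximum principle for `d u = f + T B u`. -/
theorem abs_le_of_eq (hB : IsStationaryGenerator B p) {T : ℝ} (hT : 0 ≤ T) {d u f : Fin N → ℝ}
    {c K : ℝ} (hc : 0 < c) (hK : 0 ≤ K) (hd : ∀ i, c ≤ d i) (hf : ∀ i, |f i| ≤ c * K)
    (h : ∀ i, d i * u i = f i + T * (B *ᵥ u) i) : ∀ i, |u i| ≤ K := by
  have hfd : ∀ i, |f i| ≤ d i * K := fun i => (hf i).trans (by gcongr; exact hd i)
  have hone : ∀ s : ℝ, ∀ i, (B *ᵥ (fun j => K + s * u j)) i = s * (B *ᵥ u) i := by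
    intro s i
    rw [hB.mulVec_apply, hB.mulVec_apply, Finset.mul_sum]
    exact Finset.sum_congr rfl fun j _ => by ring
  have h1 := hB.nonneg_of_eq hT (d := d) (u := fun j => K + 1 * u j) (f := fun i => d i * K + f i)
    (fun i => hc.trans_le (hd i)) (fun i => by linarith [(abs_le.1 (hfd i)).1])
    (fun i => by rw [hone]; linarith [h i])
  have h2 := hB.nonneg_of_eq hT (d := d) (u := fun j => K + -1 * u j)
    (f := fun i => d i * K - f i)
    (fun i => hc.trans_le (hd i)) (fun i => by linarith [(abs_le.1 (hfd i)).2])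
    (fun i => by rw [hone]; linarith [h i])
  intro i
  have h3 := h1 i
  have h4 := h2 i
  rw [abs_le]
  constructor <;> linarith

theorem exists_resolvent (hB : IsStationaryGenerator B p) {T : ℝ} (hT : 0 ≤ T)
    (f : Fin N → ℝ) : ∃ u : Fin N → ℝ, ∀ i, u i = f i + T * (B *ᵥ u) i := by
  obtain ⟨u, hu, -⟩ := existsUnique_of_inverse_nonneg (M := B) (T := T) (d := fun _ => 1)
    (fun u f hf h => hB.nonneg_of_eq hT (fun _ => one_pos) hf h) f
  exact ⟨u, fun i => by simpa using hu i⟩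

theorem dirichletSum_term_nonneg (hB : IsStationaryGenerator B p) (u : Fin N → ℝ) (i j : Fin N) :
    0 ≤ p i * B i j * (u j - u i) ^ 2 := by
  by_cases hij : i = j
  · subst hij; simp
  · exact mul_nonneg (mul_nonneg (hB.pos i).le (hB.offDiag i j hij)) (sq_nonneg _)

theorem dirichletSum_nonneg (hB : IsStationaryGenerator B p) (u : Fin N → ℝ) :
    0 ≤ dirichletSum B p u :=
  Finset.sum_nonneg fun i _ => Finset.sum_nonneg fun j _ => hB.dirichletSum_term_nonneg u i j

theorem dirichletSum_eq (hB : IsStationaryGenerator B p) (u : Fin N → ℝ) :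
    dirichletSum B p u = -2 * ∑ i, p i * ((B *ᵥ u) i * u i) := by
  have h1 := hB.sum_stationary (fun i => u i ^ 2)
  have h2 := hB.sum_row (fun i => u i ^ 2)
  rw [sum_mul_mulVec]
  have : dirichletSum B p u = ∑ i, ∑ j, p i * B i j * u j ^ 2
      + ∑ i, ∑ j, p i * B i j * u i ^ 2 - 2 * ∑ i, ∑ j, p i * B i j * (u j * u i) := by
    simp only [dirichletSum, Finset.mul_sum, ← Finset.sum_add_distrib, ← Finset.sum_sub_distrib]
    exact Finset.sum_congr rfl fun i _ => Finset.sum_congr rfl fun j _ => by ring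
  rw [this, h1, h2]
  ring

theorem sum_mul_mulVec_self_nonpos (hB : IsStationaryGenerator B p) (u : Fin N → ℝ) :
    ∑ i, p i * ((B *ᵥ u) i * u i) ≤ 0 := by
  linarith [hB.dirichletSum_eq u, hB.dirichletSum_nonneg u]

/-- A harmonic `u` has zero Dirichlet sum, so it cannot vary across an edge with nonzero rate.
Positivity of `p` enters here. -/
theorem eq_of_mulVec_eq_zero (hB : IsStationaryGenerator B p) {u : Fin N → ℝ}
    (hu : B *ᵥ u = 0) {i j : Fin N} (hij : B i j ≠ 0) : u i = u j := by
  have h0 : dirichletSum B p u = 0 := by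
    rw [hB.dirichletSum_eq, hu]; simp
  have h1 := (Finset.sum_eq_zero_iff_of_nonneg (fun i _ => Finset.sum_nonneg fun j _ =>
    hB.dirichletSum_term_nonneg u i j)).1 h0 i (Finset.mem_univ i)
  have h2 := (Finset.sum_eq_zero_iff_of_nonneg (fun j _ =>
    hB.dirichletSum_term_nonneg u i j)).1 h1 j (Finset.mem_univ j)
  have h3 : (u j - u i) ^ 2 = 0 := (mul_eq_zero.1 h2).resolve_left (mul_ne_zero (hB.pos i).ne' hij)
  have h4 := pow_eq_zero_iff (two_ne_zero) |>.1 h3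
  linarith

theorem eq_classRep (hB : IsStationaryGenerator B p) {u : Fin N → ℝ} (hu : B *ᵥ u = 0)
    (i : Fin N) : u i = u (classRep B i) := by
  have h : Relation.EqvGen (fun i j => B i j ≠ 0) (classRep B i) i :=
    Quot.eqvGen_exact (Quot.out_eq _)
  generalize classRep B i = k at h
  induction h with
  | rel x y hxy => exact (hB.eq_of_mulVec_eq_zero hu hxy).symm
  | refl x => rfl
  | symm x y _ ih => exact ih.symm
  | trans x y z _ _ ih1 ih2 => exact ih2.trans ih1

theorem exists_abs_sub_classRep_le (hB : IsStationaryGenerator B p) :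
    ∃ G > 0, ∀ (u : Fin N → ℝ) (i : Fin N), |u i - u (classRep B i)| ≤ G * ‖B *ᵥ u‖ := by
  let g : (Fin N → ℝ) →ₗ[ℝ] (Fin N → ℝ) :=
    LinearMap.pi fun i => (LinearMap.proj i : (Fin N → ℝ) →ₗ[ℝ] ℝ) - LinearMap.proj (classRep B i)
  obtain ⟨G, hG, h⟩ := exists_norm_le_of_ker_le B.mulVecLin g (fun u hu => by
    rw [LinearMap.mem_ker, Matrix.mulVecLin_apply] at hu
    rw [LinearMap.mem_ker]
    ext i
    simp only [g, LinearMap.pi_apply, LinearMap.sub_apply, LinearMap.proj_apply, Pi.zero_apply]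
    exact sub_eq_zero.2 (hB.eq_classRep hu i))
  exact ⟨G, hG, fun u i => (norm_le_pi_norm (g u) i).trans (h u)⟩

/-- No rate leads from one class to another, so the stationarity of `p` holds on each class
separately. -/
theorem sum_mulVec_mul_classConst (hB : IsStationaryGenerator B p) (u g : Fin N → ℝ) :
    ∑ i, p i * ((B *ᵥ u) i * g (classRep B i)) = 0 := by
  rw [sum_mul_mulVec, ← hB.sum_stationary (fun j => u j * g (classRep B j))]
  refine Finset.sum_congr rfl fun i _ => Finset.sum_congr rfl fun j _ => ?_
  by_cases hij : B i j = 0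
  · simp [hij]
  · have : classRep B i = classRep B j := by
      unfold classRep
      rw [Quot.sound (r := fun i j => B i j ≠ 0) hij]
    rw [this]

/-- Subtracting the class-constant part of `g` is free. This gains the factor `1 / T` that makes the
error bounds uniform for large steps. -/
theorem abs_sum_mulVec_mul_le (hB : IsStationaryGenerator B p) {u g : Fin N → ℝ} {b K : ℝ}
    (hb : ∀ i, |(B *ᵥ u) i| ≤ b) (hg : ∀ i, |g i - g (classRep B i)| ≤ K) :
    |∑ i, p i * ((B *ᵥ u) i * g i)| ≤ (∑ i, p i) * (b * K) := by
  have : ∑ i, p i * ((B *ᵥ u) i * g i)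
      = ∑ i, p i * ((B *ᵥ u) i * (g i - g (classRep B i))) := by
    rw [← sub_zero (∑ i, p i * ((B *ᵥ u) i * g i)), ← hB.sum_mulVec_mul_classConst u g,
      ← Finset.sum_sub_distrib]
    exact Finset.sum_congr rfl fun i _ => by ring
  rw [this, Finset.sum_mul]
  refine (Finset.abs_sum_le_sum_abs _ _).trans (Finset.sum_le_sum fun i _ => ?_)
  rw [abs_mul, abs_mul, abs_of_pos (hB.pos i)]
  have := hB.pos i
  have := (abs_nonneg _).trans (hb i)
  gcongr
  · exact hb i
  · exact hg i

/-- If `B u` is harmonic it is constant on classes, so `∑ p_i (B u)_i²` is a sum of the vanishing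
kind above. The eigenvalue `0` has no Jordan block. -/
theorem eq_zero_of_mulVec_mulVec (hB : IsStationaryGenerator B p) {u : Fin N → ℝ}
    (hu : B *ᵥ (B *ᵥ u) = 0) : B *ᵥ u = 0 := by
  have h1 := hB.sum_mulVec_mul_classConst u (B *ᵥ u)
  simp only [← hB.eq_classRep hu] at h1
  have h2 := (Finset.sum_eq_zero_iff_of_nonneg (fun i _ =>
    mul_nonneg (hB.pos i).le (mul_self_nonneg ((B *ᵥ u) i)))).1 h1
  ext i
  have h3 := (mul_eq_zero.1 (h2 i (Finset.mem_univ i))).resolve_left (hB.pos i).ne'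
  simpa using h3

theorem exists_norm_mulVec_le (hB : IsStationaryGenerator B p) :
    ∃ C > 0, ∀ u : Fin N → ℝ, ‖B *ᵥ u‖ ≤ C * ‖B *ᵥ (B *ᵥ u)‖ :=
  exists_norm_le_of_ker_le (B.mulVecLin ∘ₗ B.mulVecLin) B.mulVecLin fun _ hu =>
    hB.eq_zero_of_mulVec_mulVec hu

theorem exists_norm_sq_le_dirichletSum (hB : IsStationaryGenerator B p) :
    ∃ K > 0, ∀ u : Fin N → ℝ, ‖B *ᵥ u‖ ^ 2 ≤ K * dirichletSum B p u := by
  -- Cauchy–Schwarz weights: the square of `B i j * (u j - u i)` is `|B i j| / p i` times the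
  -- Dirichlet term. The absolute value only matters on the diagonal, where the difference is zero.
  let c : Fin N → ℝ := fun i => ∑ j, |B i j| / p i
  have hc : ∀ i, 0 ≤ c i := fun i =>
    Finset.sum_nonneg fun j _ => div_nonneg (abs_nonneg _) (hB.pos i).le
  have hK : 0 < 1 + ∑ i, c i := by
    have := Finset.sum_nonneg fun i (_ : i ∈ Finset.univ) => hc i
    linarith
  refine ⟨1 + ∑ i, c i, hK, fun u => ?_⟩
  have hD := hB.dirichletSum_nonneg u
  have h1 : ∀ i, (B *ᵥ u) i ^ 2 ≤ (1 + ∑ i, c i) * dirichletSum B p u := by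
    intro i
    rw [hB.mulVec_apply]
    refine (Finset.sum_sq_le_sum_mul_sum_of_sq_le_mul Finset.univ
      (f := fun j => |B i j| / p i) (g := fun j => p i * B i j * (u j - u i) ^ 2)
      (fun j _ => div_nonneg (abs_nonneg _) (hB.pos i).le)
      (fun j _ => hB.dirichletSum_term_nonneg u i j) fun j _ => ?_).trans ?_
    · by_cases hij : i = j
      · subst hij; simp
      · rw [abs_of_nonneg (hB.offDiag i j hij)]
        have := (hB.pos i).ne'
        apply le_of_eq
        field_simp
    · have h2 : ∑ j, |B i j| / p i ≤ 1 + ∑ i, c i := by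
        have := Finset.single_le_sum (f := c) (fun i _ => hc i) (Finset.mem_univ i)
        simp only [c] at this ⊢
        linarith
      have h3 : ∑ j, p i * B i j * (u j - u i) ^ 2 ≤ dirichletSum B p u :=
        Finset.single_le_sum (f := fun i => ∑ j, p i * B i j * (u j - u i) ^ 2)
          (fun i _ => Finset.sum_nonneg fun j _ => hB.dirichletSum_term_nonneg u i j)
          (Finset.mem_univ i)
      exact mul_le_mul h2 h3
        (Finset.sum_nonneg fun j _ => hB.dirichletSum_term_nonneg u i j) hK.le
  have h2 : ‖B *ᵥ u‖ ≤ √((1 + ∑ i, c i) * dirichletSum B p u) :=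
    (pi_norm_le_iff_of_nonneg (Real.sqrt_nonneg _)).2 fun i => Real.abs_le_sqrt (h1 i)
  calc ‖B *ᵥ u‖ ^ 2 ≤ √((1 + ∑ i, c i) * dirichletSum B p u) ^ 2 := by gcongr
    _ = _ := Real.sq_sqrt (mul_nonneg hK.le hD)

/-- Entropy dissipation for the convex function `1 / s`. -/
theorem dirichletSum_le_sum_div_sq (hB : IsStationaryGenerator B p) {V : Fin N → ℝ}
    (hV : ∀ i, 0 < V i) (hV' : ∀ i, V i ≤ 3 / 2) :
    dirichletSum B p V / 4 ≤ ∑ i, p i * ((B *ᵥ V) i * (1 / V i ^ 2)) := by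
  -- Adding sums that vanish by stationarity or by zero row sums turns the summand into the
  -- second-order Taylor remainder of `1 / s` at `V i`, evaluated at `V j`.
  have h0 : ∑ i, p i * ((B *ᵥ V) i * (1 / V i ^ 2))
      = ∑ i, ∑ j, p i * B i j * ((V j - V i) ^ 2 / (V i ^ 2 * V j)) := by
    have h1 := hB.sum_stationary (fun i => 1 / V i)
    have h2 := hB.sum_row (fun i => 1 / V i)
    have h3 := hB.sum_row (fun i => V i * (1 / V i ^ 2))
    rw [sum_mul_mulVec]
    have : ∑ i, ∑ j, p i * B i j * (V j * (1 / V i ^ 2))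
        = ∑ i, ∑ j, p i * B i j * ((V j - V i) ^ 2 / (V i ^ 2 * V j))
          + ∑ i, ∑ j, p i * B i j * (1 / V i) - ∑ i, ∑ j, p i * B i j * (1 / V j)
          + ∑ i, ∑ j, p i * B i j * (V i * (1 / V i ^ 2)) := by
      simp only [← Finset.sum_add_distrib, ← Finset.sum_sub_distrib]
      refine Finset.sum_congr rfl fun i _ => Finset.sum_congr rfl fun j _ => ?_
      have := (hV i).ne'
      have := (hV j).ne'
      field_simp
      ring
    rw [this, h1, h2, h3]
    ring
  rw [h0, dirichletSum, Finset.sum_div]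
  refine Finset.sum_le_sum fun i _ => ?_
  rw [Finset.sum_div]
  refine Finset.sum_le_sum fun j _ => ?_
  have h1 : 0 < V i ^ 2 * V j := mul_pos (pow_pos (hV i) 2) (hV j)
  have h2 : V i ^ 2 * V j ≤ 4 := by
    have : V i ^ 2 * V j ≤ (3 / 2) ^ 2 * (3 / 2) := by
      have := hV i
      have := hV j
      gcongr
      · exact hV' i
      · exact hV' j
    linarith
  have h3 := hB.dirichletSum_term_nonneg V i j
  rw [← mul_div_assoc]
  exact div_le_div_of_nonneg_left h3 h1 h2

end IsStationaryGenerator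

/-! ### The Patankar weight near a steady state -/

theorem rpow_bernoulli_gap {r γ : ℝ} (hr : |r| ≤ 1 / 2) (h0 : 0 ≤ γ) (h1 : γ ≤ 1) :
    0 ≤ 1 + γ * r - (1 + r) ^ γ ∧ 1 + γ * r - (1 + r) ^ γ ≤ 2 * (γ * (1 - γ)) * r ^ 2 := by
  obtain ⟨hr1, hr2⟩ := abs_le.1 hr
  have hr3 : 0 < 1 + r := by linarith
  have hu : 0 < (1 + r) ^ γ := Real.rpow_pos_of_pos hr3 γ
  have hle := rpow_one_add_le_one_add_mul_self (s := r) (by linarith) h0 h1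
  refine ⟨sub_nonneg.2 hle, ?_⟩
  -- Bernoulli for the inverse base bounds the power from below. The factor `1 - γ` is kept because
  -- it must vanish at `α = 1/2`, where the dissipation in `b` also vanishes.
  have hinv : ((1 + r) ^ γ)⁻¹ ≤ (1 + (1 - γ) * r) / (1 + r) := by
    have h2 := rpow_one_add_le_one_add_mul_self (s := (1 + r)⁻¹ - 1)
      (by have := inv_pos.2 hr3; linarith) h0 h1
    rw [add_sub_cancel, Real.inv_rpow hr3.le] at h2
    refine h2.trans (le_of_eq ?_)
    field_simp
    ring
  have hq : 1 / 2 ≤ 1 + (1 - γ) * r := by nlinarith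
  have hlow : (1 + r) / (1 + (1 - γ) * r) ≤ (1 + r) ^ γ := by
    have := inv_anti₀ (inv_pos.2 hu) hinv
    rwa [inv_inv, inv_div] at this
  have h3 : 1 + γ * r - (1 + r) / (1 + (1 - γ) * r)
      = γ * (1 - γ) * r ^ 2 / (1 + (1 - γ) * r) := by
    have hq0 : 1 + (1 - γ) * r ≠ 0 := by linarith
    rw [sub_eq_iff_eq_add, ← add_div, eq_div_iff hq0]
    ring
  have h4 : γ * (1 - γ) * r ^ 2 / (1 + (1 - γ) * r) ≤ 2 * (γ * (1 - γ)) * r ^ 2 := by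
    have h5 : 0 ≤ γ * (1 - γ) * r ^ 2 :=
      mul_nonneg (mul_nonneg h0 (by linarith)) (sq_nonneg _)
    rw [div_le_iff₀ (by linarith)]
    nlinarith
  linarith

theorem div_patankarWeight_eq {α s t : ℝ} (hα : 1 / 2 ≤ α) (hs : 0 < s) (ht : 0 < t) :
    s / patankarWeight α s t
      = s * ((1 + (t - s) / s) ^ (1 / (2 * α))) ^ 2 / (1 + 1 / (2 * α) * ((t - s) / s)) := by
  have hα0 : α ≠ 0 := by linarith
  have h1 : 1 + (t - s) / s = t / s := by field_simp; ring
  have h2 : t ^ (1 / α) * s ^ (1 - 1 / α) = s * ((t / s) ^ (1 / (2 * α))) ^ 2 := by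
    rw [← Real.rpow_natCast, ← Real.rpow_mul (by positivity), Real.rpow_sub hs, Real.rpow_one]
    have : 1 / (2 * α) * ((2 : ℕ) : ℝ) = 1 / α := by push_cast; field_simp
    rw [this, Real.div_rpow ht.le hs.le]
    have := (Real.rpow_pos_of_pos hs (1 / α)).ne'
    field_simp
  have h3 : (1 - 1 / (2 * α)) * s + 1 / (2 * α) * t
      = s * (1 + 1 / (2 * α) * ((t - s) / s)) := by
    field_simp
    ring
  rw [patankarWeight, h2, h3, h1, div_div_eq_mul_div,
    mul_div_mul_left _ _ hs.ne']

/-- With `γ = 1/(2α)` and `r = (t - s)/s`, the leading term is `s (1 + γ r) = s + a/2`, and the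
error factors through the Bernoulli gap. One factor `r` becomes `δ`; the other is kept, with `γ`, as
`|a|`, which makes the bound uniform in `α`. -/
theorem abs_sub_div_patankarWeight_le {α δ s t a : ℝ} (hα : 1 / 2 ≤ α) (hδ : δ ≤ 1 / 100)
    (hs : |s - 1| ≤ δ) (ht : |t - 1| ≤ δ) (ha : α * a = t - s) :
    |s + a / 2 - s / patankarWeight α s t| ≤ 6 * δ * (1 - 1 / (2 * α)) * |a| := by
  have hα0 : 0 < α := by linarith
  obtain ⟨hs1, hs2⟩ := abs_le.1 hs
  obtain ⟨ht1, ht2⟩ := abs_le.1 ht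
  have hs0 : 0 < s := by linarith
  have ht0 : 0 < t := by linarith
  rw [div_patankarWeight_eq hα hs0 ht0]
  set γ := 1 / (2 * α) with hγ
  set r := (t - s) / s with hr
  have hγ0 : 0 ≤ γ := by positivity
  have hγ1 : γ ≤ 1 := by rw [hγ, div_le_one (by linarith)]; linarith
  have hγr : s * (γ * r) = a / 2 := by
    rw [hr, hγ, ← ha]; field_simp
  have hr1 : |r| ≤ 3 * δ := by
    rw [hr, abs_div, abs_of_pos hs0, div_le_iff₀ hs0, abs_le]
    constructor <;> nlinarith
  obtain ⟨hg0, hg1⟩ := rpow_bernoulli_gap (hr1.trans (by linarith)) hγ0 hγ1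
  set u := (1 + r) ^ γ
  have hu : 0 ≤ u := Real.rpow_nonneg (by have := (abs_le.1 hr1).1; linarith) _
  have hW : 0 < 1 + γ * r := by
    have := (abs_le.1 hr1).1
    nlinarith
  have h1 : s + a / 2 - s * u ^ 2 / (1 + γ * r)
      = s * (1 + γ * r - u) * ((1 + γ * r + u) / (1 + γ * r)) := by
    rw [← hγr]
    field_simp
    ring
  have h2 : (1 + γ * r + u) / (1 + γ * r) ≤ 2 := by
    rw [div_le_iff₀ hW]; linarith
  have h3 : 0 ≤ (1 + γ * r + u) / (1 + γ * r) := by positivity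
  have h4 : 0 ≤ s * (1 + γ * r - u) := mul_nonneg hs0.le hg0
  rw [h1, abs_of_nonneg (mul_nonneg h4 h3)]
  have habs : |a| = 2 * s * γ * |r| := by
    have : a = 2 * s * γ * r := by linarith
    rw [this, abs_mul, abs_of_nonneg (by positivity)]
  calc s * (1 + γ * r - u) * ((1 + γ * r + u) / (1 + γ * r))
      ≤ s * (2 * (γ * (1 - γ)) * r ^ 2) * 2 := by gcongr
    _ = 2 * (1 - γ) * (2 * s * γ * |r|) * |r| := by rw [← sq_abs r]; ring
    _ = 2 * (1 - γ) * |a| * |r| := by rw [habs]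
    _ ≤ 2 * (1 - γ) * |a| * (3 * δ) := by
        have : 0 ≤ 1 - γ := by linarith
        gcongr
    _ = _ := by ring

/-! ### Decay of the Lyapunov function in one step -/

/-- Primed quantities are values at the class representative. This bounds the variation inside a
class of the factors that multiply `B V` and `B e` in the expansion of `1 / x1 - 1 / x`. -/
theorem abs_div_sub_div_le {e e' v v' V V' δ Y : ℝ} (hδ : δ ≤ 1 / 100) (hY : 0 ≤ Y)
    (hv : |v - 1| ≤ 4 * δ) (hv' : |v' - 1| ≤ 4 * δ) (hV : |V - 1| ≤ 3 * δ)
    (hV' : |V' - 1| ≤ 3 * δ) (he' : |e'| ≤ δ) (hee : |e - e'| ≤ 20 * δ * Y)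
    (hvv : |v - v'| ≤ 2 * Y) (hVV : |V - V'| ≤ Y) :
    |e / (v * V ^ 2) - e' / (v' * V' ^ 2)| ≤ 60 * δ * Y ∧
      |1 / (v * V) - 1 / (v' * V')| ≤ 5 * Y := by
  have hδ0 : 0 ≤ δ := (abs_nonneg _).trans he'
  obtain ⟨v1, v2⟩ := abs_le.1 hv
  obtain ⟨v1', v2'⟩ := abs_le.1 hv'
  obtain ⟨V1, V2⟩ := abs_le.1 hV
  obtain ⟨V1', V2'⟩ := abs_le.1 hV'
  have a1 : 96 / 100 ≤ v := by linarith
  have a2 : v ≤ 104 / 100 := by linarith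
  have a1' : 96 / 100 ≤ v' := by linarith
  have a2' : v' ≤ 104 / 100 := by linarith
  have b1 : 97 / 100 ≤ V := by linarith
  have b2 : V ≤ 103 / 100 := by linarith
  have b1' : 97 / 100 ≤ V' := by linarith
  have b2' : V' ≤ 103 / 100 := by linarith
  have hv0 : 0 < v := by linarith
  have hv0' : 0 < v' := by linarith
  have hV0 : 0 < V := by linarith
  have hV0' : 0 < V' := by linarith
  have d1 : 93 / 100 ≤ v * V := by
    calc (93 / 100 : ℝ) ≤ (96 / 100) * (97 / 100) := by norm_num
      _ ≤ v * V := by gcongr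
  have d1' : 93 / 100 ≤ v' * V' := by
    calc (93 / 100 : ℝ) ≤ (96 / 100) * (97 / 100) := by norm_num
      _ ≤ v' * V' := by gcongr
  have d2 : 90 / 100 ≤ v * V ^ 2 := by
    calc (90 / 100 : ℝ) ≤ (96 / 100) * (97 / 100) ^ 2 := by norm_num
      _ ≤ v * V ^ 2 := by gcongr
  have d2' : 90 / 100 ≤ v' * V' ^ 2 := by
    calc (90 / 100 : ℝ) ≤ (96 / 100) * (97 / 100) ^ 2 := by norm_num
      _ ≤ v' * V' ^ 2 := by gcongr
  have c2' : v' * V' ^ 2 ≤ 112 / 100 := by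
    calc v' * V' ^ 2 ≤ (104 / 100) * (103 / 100) ^ 2 := by gcongr
      _ ≤ 112 / 100 := by norm_num
  have m1 : |v' * V' - v * V| ≤ 4 * Y := by
    have : v' * V' - v * V = -((v - v') * V' + v * (V - V')) := by ring
    rw [this, abs_neg]
    calc _ ≤ |(v - v') * V'| + |v * (V - V')| := abs_add_le _ _
      _ = |v - v'| * V' + v * |V - V'| := by
        rw [abs_mul, abs_mul, abs_of_pos hV0', abs_of_pos hv0]
      _ ≤ 2 * Y * (103 / 100) + (104 / 100) * Y := by gcongr
      _ ≤ 4 * Y := by linarith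
  have m2 : |v' * V' ^ 2 - v * V ^ 2| ≤ 6 * Y := by
    have : v' * V' ^ 2 - v * V ^ 2
        = -((v - v') * V' ^ 2 + v * (V + V') * (V - V')) := by ring
    rw [this, abs_neg]
    calc _ ≤ |(v - v') * V' ^ 2| + |v * (V + V') * (V - V')| := abs_add_le _ _
      _ = |v - v'| * V' ^ 2 + v * (V + V') * |V - V'| := by
        rw [abs_mul, abs_mul, abs_of_pos (pow_pos hV0' 2),
          abs_of_pos (mul_pos hv0 (add_pos hV0 hV0'))]
      _ ≤ 2 * Y * (103 / 100) ^ 2 + (104 / 100) * (103 / 100 + 103 / 100) * Y := by gcongr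
      _ ≤ 6 * Y := by linarith
  constructor
  · have h1 : e / (v * V ^ 2) - e' / (v' * V' ^ 2)
        = ((e - e') * (v' * V' ^ 2) + e' * (v' * V' ^ 2 - v * V ^ 2))
          / ((v * V ^ 2) * (v' * V' ^ 2)) := by
      field_simp
      ring
    have h2 : 81 / 100 ≤ (v * V ^ 2) * (v' * V' ^ 2) := by
      calc (81 / 100 : ℝ) ≤ (90 / 100) * (90 / 100) := by norm_num
        _ ≤ _ := by gcongr
    rw [h1, abs_div, abs_of_pos (by linarith : 0 < (v * V ^ 2) * (v' * V' ^ 2)),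
      div_le_iff₀ (by linarith)]
    calc _ ≤ |(e - e') * (v' * V' ^ 2)| + |e' * (v' * V' ^ 2 - v * V ^ 2)| := abs_add_le _ _
      _ = |e - e'| * (v' * V' ^ 2) + |e'| * |v' * V' ^ 2 - v * V ^ 2| := by
        rw [abs_mul, abs_mul e', abs_of_pos (by linarith : 0 < v' * V' ^ 2)]
      _ ≤ 20 * δ * Y * (112 / 100) + δ * (6 * Y) := by gcongr
      _ ≤ 60 * δ * Y * (81 / 100) := by nlinarith [mul_nonneg hδ0 hY]
      _ ≤ _ := by gcongr
  · have h1 : 1 / (v * V) - 1 / (v' * V') = (v' * V' - v * V) / ((v * V) * (v' * V')) := by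
      field_simp
    have h2 : 86 / 100 ≤ (v * V) * (v' * V') := by
      calc (86 / 100 : ℝ) ≤ (93 / 100) * (93 / 100) := by norm_num
        _ ≤ _ := by gcongr
    rw [h1, abs_div, abs_of_pos (by linarith : 0 < (v * V) * (v' * V')),
      div_le_iff₀ (by linarith)]
    nlinarith

/-- Pointwise expansion of `1 / x1 - 1 / x`, where `x1 - x = P + E`, `x * x1 = v * Z` and
`v = V + e`, around the leading term `-P / V ^ 2`. -/
theorem abs_inv_sub_inv_expansion_le {x x1 v V e Z P E μ b δ M s : ℝ} (hδ : δ ≤ 1 / 100)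
    (hx : 0 < x) (hx1 : 0 < x1) (hxx : x1 - x = P + E) (hZ : x * x1 = v * Z) (he : v = V + e)
    (hv : |v - 1| ≤ 4 * δ) (hV : |V - 1| ≤ 3 * δ) (hX : |V + μ * b - 1| ≤ 3 * δ)
    (hP : |P| ≤ M) (hE : |E| ≤ 20 * δ * M) (hμ : 0 ≤ μ) (hs : 0 ≤ s) (hs1 : s ≤ 1)
    (hM : M ≤ 6 * δ)
    (hZX : |V + μ * b - Z| ≤ 6 * δ * s * M) :
    1 / x1 - 1 / x ≤ -(P * (1 / V ^ 2)) + P * (e / (v * V ^ 2)) - E * (1 / (v * V))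
      + μ * (P * b) + 60 * δ * (μ * |b| * M + s * M ^ 2) := by
  have hM0 : 0 ≤ M := (abs_nonneg _).trans hP
  have hδ0 : 0 ≤ δ := by linarith
  obtain ⟨v1, v2⟩ := abs_le.1 hv
  obtain ⟨V1, V2⟩ := abs_le.1 hV
  obtain ⟨X1, X2⟩ := abs_le.1 hX
  obtain ⟨Z1, Z2⟩ := abs_le.1 hZX
  set X := V + μ * b with hXdef
  have hsM : 6 * δ * s * M ≤ 36 / 100 * δ := by
    have : s * M ≤ 1 * (6 * δ) := by gcongr
    nlinarith
  have a1 : 96 / 100 ≤ v := by linarith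
  have b1 : 97 / 100 ≤ V := by linarith
  have c1 : 97 / 100 ≤ X := by linarith
  have e1 : 96 / 100 ≤ Z := by linarith
  have hv0 : v ≠ 0 := by linarith
  have hV0 : V ≠ 0 := by linarith
  have hX0 : X ≠ 0 := by linarith
  have hZ0 : Z ≠ 0 := by linarith
  have h1 : 1 / x1 - 1 / x = -(P + E) / (v * Z) := by
    rw [← hZ, ← hxx]
    field_simp
    ring
  -- Exact remainder: `Z` is replaced by `X`, then `X` by `V` at the price of a factor `μ b`, and
  -- finally `1 / v = 1 / V - e / (v V)` is used for `P`.
  have h2 : -(P + E) / (v * Z) - (-(P * (1 / V ^ 2)) + P * (e / (v * V ^ 2)) - E * (1 / (v * V))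
      + μ * (P * b))
      = μ * b * ((E - P * (v * V * X - 1)) / (v * V * X)) - (P + E) * (X - Z) / (v * X * Z) := by
    have hb : μ * b = X - V := by rw [hXdef]; ring
    have hb' : μ * (P * b) = P * (X - V) := by rw [← hb]; ring
    have he' : e = v - V := by linarith
    rw [hb, hb', he']
    field_simp
    ring
  have g1 : 88 / 100 ≤ v * V * X := by
    calc (88 / 100 : ℝ) ≤ (96 / 100) * (97 / 100) * (97 / 100) := by norm_num
      _ ≤ _ := by gcongr
  have g2 : 88 / 100 ≤ v * X * Z := by
    calc (88 / 100 : ℝ) ≤ (96 / 100) * (97 / 100) * (96 / 100) := by norm_num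
      _ ≤ _ := by gcongr
  have g3 : |v * V * X - 1| ≤ 12 * δ := by
    have : v * V * X - 1 = (v - 1) * (V * X) + (V - 1) * X + (X - 1) := by ring
    have hVp : 0 < V := by linarith
    have hXp : 0 < X := by linarith
    rw [this]
    calc _ ≤ |(v - 1) * (V * X)| + |(V - 1) * X| + |X - 1| := abs_add_three _ _ _
      _ = |v - 1| * (V * X) + |V - 1| * X + |X - 1| := by
        rw [abs_mul, abs_mul (V - 1), abs_of_pos hXp, abs_of_pos (mul_pos hVp hXp)]
      _ ≤ (4 * δ) * ((103 / 100) * (103 / 100)) + (3 * δ) * (103 / 100) + 3 * δ := by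
        gcongr <;> linarith
      _ ≤ 12 * δ := by linarith
  have k1 : |(E - P * (v * V * X - 1)) / (v * V * X)| ≤ 60 * δ * M := by
    rw [abs_div, abs_of_pos (by linarith : 0 < v * V * X), div_le_iff₀ (by linarith)]
    calc _ ≤ |E| + |P * (v * V * X - 1)| := abs_sub _ _
      _ = |E| + |P| * |v * V * X - 1| := by rw [abs_mul]
      _ ≤ 20 * δ * M + M * (12 * δ) := by gcongr
      _ ≤ 60 * δ * M * (88 / 100) := by nlinarith [mul_nonneg hδ0 hM0]
      _ ≤ _ := by gcongr
  have k2 : |(P + E) * (X - Z) / (v * X * Z)| ≤ 60 * δ * (s * M ^ 2) := by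
    rw [abs_div, abs_of_pos (by linarith : 0 < v * X * Z), div_le_iff₀ (by linarith)]
    have : |P + E| ≤ 2 * M := by
      refine (abs_add_le _ _).trans ?_
      have := mul_le_mul_of_nonneg_right hδ hM0
      linarith
    calc _ = |P + E| * |X - Z| := abs_mul _ _
      _ ≤ (2 * M) * (6 * δ * s * M) :=
        mul_le_mul this hZX (abs_nonneg _) (by linarith)
      _ = 12 * (δ * s * M ^ 2) := by ring
      _ ≤ 60 * δ * (s * M ^ 2) * (88 / 100) := by
        have : 0 ≤ δ * s * M ^ 2 := by positivity
        linarith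
      _ ≤ _ := mul_le_mul_of_nonneg_left g2 (by positivity)
  have k3 : |μ * b * ((E - P * (v * V * X - 1)) / (v * V * X))| ≤ μ * |b| * (60 * δ * M) := by
    rw [abs_mul, abs_mul, abs_of_nonneg hμ]
    gcongr
  have k4 := (abs_le.1 k3).2
  have k5 := (abs_le.1 k2).1
  rw [h1]
  linarith

/-- The linear error equation `d e = f + T B e` has a source term that is small compared with
`a`. -/
theorem abs_source_le {x a V d δ s : ℝ} (hδ : δ ≤ 1 / 100) (hx : |x - 1| ≤ δ)
    (hV : |V - 1| ≤ 3 * δ) (ha : |a| ≤ 4 * δ) (hs1 : s ≤ 1)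
    (hd : |x + a / 2 - x * d| ≤ 6 * δ * s * |a|) :
    9 / 10 ≤ d ∧ d ≤ 11 / 10 ∧ |(1 - d) * V + a / 2| ≤ 9 * δ * |a| := by
  have hδ0 : 0 ≤ δ := (abs_nonneg _).trans hx
  obtain ⟨x1, x2⟩ := abs_le.1 hx
  obtain ⟨V1, V2⟩ := abs_le.1 hV
  obtain ⟨a1, a2⟩ := abs_le.1 ha
  have hd' : |x + a / 2 - x * d| ≤ 6 * δ * |a| := by
    refine hd.trans ?_
    have : 6 * δ * s * |a| ≤ 6 * δ * 1 * |a| := by gcongr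
    linarith
  have hda : 6 * δ * |a| ≤ 24 / 100 * δ := by
    nlinarith
  obtain ⟨d1, d2⟩ := abs_le.1 hd'
  have hx0 : 0 < x := by linarith
  refine ⟨?_, ?_, ?_⟩
  · by_contra h
    push Not at h
    nlinarith
  · by_contra h
    push Not at h
    nlinarith
  · have h1 : (1 - d) * V + a / 2
        = (V * (x + a / 2 - x * d) + (x - V) * (a / 2)) / x := by
      field_simp
      ring
    rw [h1, abs_div, abs_of_pos hx0, div_le_iff₀ hx0]
    have hVp : 0 < V := by linarith
    have hxV : |x - V| ≤ 4 * δ := by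
      rw [abs_le]; constructor <;> linarith
    calc _ ≤ |V * (x + a / 2 - x * d)| + |(x - V) * (a / 2)| := abs_add_le _ _
      _ = V * |x + a / 2 - x * d| + |x - V| * (|a| / 2) := by
        rw [abs_mul, abs_mul, abs_of_pos hVp, abs_div, abs_two]
      _ ≤ (103 / 100) * (6 * δ * |a|) + 4 * δ * (|a| / 2) := by gcongr; linarith
      _ ≤ 9 * δ * |a| * (99 / 100) := by nlinarith [mul_nonneg hδ0 (abs_nonneg a)]
      _ ≤ _ := by gcongr; linarith

theorem exists_mul_norm_sq_le_sum {N : ℕ} {p : Fin N → ℝ} (hp : ∀ i, 0 < p i) :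
    ∃ ρ > 0, ∀ b : Fin N → ℝ, ρ * ‖b‖ ^ 2 ≤ ∑ i, p i * (b i * b i) := by
  have hS : 0 < 1 + ∑ i, (p i)⁻¹ := by
    have := Finset.sum_nonneg fun i (_ : i ∈ Finset.univ) => (inv_pos.2 (hp i)).le
    linarith
  refine ⟨(1 + ∑ i, (p i)⁻¹)⁻¹, inv_pos.2 hS, fun b => ?_⟩
  have hsum : 0 ≤ ∑ i, p i * (b i * b i) :=
    Finset.sum_nonneg fun i _ => mul_nonneg (hp i).le (mul_self_nonneg _)
  rw [inv_mul_le_iff₀ hS]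
  have h1 : ∀ i, b i ^ 2 ≤ (1 + ∑ i, (p i)⁻¹) * ∑ i, p i * (b i * b i) := by
    intro i
    have h2 : p i * (b i * b i) ≤ ∑ i, p i * (b i * b i) :=
      Finset.single_le_sum (f := fun i => p i * (b i * b i))
        (fun i _ => mul_nonneg (hp i).le (mul_self_nonneg _)) (Finset.mem_univ i)
    have h3 : (p i)⁻¹ ≤ 1 + ∑ i, (p i)⁻¹ := by
      have := Finset.single_le_sum (f := fun i => (p i)⁻¹)
        (fun i _ => (inv_pos.2 (hp i)).le) (Finset.mem_univ i)
      linarith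
    calc b i ^ 2 = (p i)⁻¹ * (p i * (b i * b i)) := by
          have := (hp i).ne'
          field_simp
      _ ≤ _ := mul_le_mul h3 h2 (mul_nonneg (hp i).le (mul_self_nonneg _)) hS.le
  have h2 : ‖b‖ ≤ √((1 + ∑ i, (p i)⁻¹) * ∑ i, p i * (b i * b i)) :=
    (pi_norm_le_iff_of_nonneg (Real.sqrt_nonneg _)).2 fun i => Real.abs_le_sqrt (h1 i)
  calc ‖b‖ ^ 2 ≤ √((1 + ∑ i, (p i)⁻¹) * ∑ i, p i * (b i * b i)) ^ 2 := by gcongr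
    _ = _ := Real.sq_sqrt (mul_nonneg hS.le hsum)

namespace IsStationaryGenerator

variable {N : ℕ} {B : Matrix (Fin N) (Fin N) ℝ} {p : Fin N → ℝ}

theorem abs_sub_one_le_of_eq (hB : IsStationaryGenerator B p) {T δ : ℝ} (hT : 0 ≤ T)
    (hδ : 0 ≤ δ) {u f : Fin N → ℝ} (hf : ∀ i, |f i - 1| ≤ δ)
    (h : ∀ i, u i = f i + T * (B *ᵥ u) i) : ∀ i, |u i - 1| ≤ δ := by
  have h1 := hB.abs_le_of_eq hT (d := fun _ => 1) (u := u - 1) (f := f - 1) one_pos hδ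
    (fun _ => le_rfl) (fun i => by simpa using hf i) (fun i => by
      rw [Matrix.mulVec_sub, hB.mulVec_one, sub_zero]
      simp only [Pi.sub_apply, Pi.one_apply, one_mul]
      linarith [h i])
  exact h1

/-- The linear part of one step: the modified stage value `V` and its relation to the increments
`a = T B x2`, `h` and `b = T B h`. -/
theorem exists_linear_stage (hB : IsStationaryGenerator B p) {T α δ : ℝ} (hT : 0 < T)
    (hα : 1 / 2 ≤ α) {x x2 : Fin N → ℝ} (hx : ∀ i, |x i - 1| ≤ δ) (hδ : 0 ≤ δ)
    (hx2 : ∀ i, x2 i = x i + α * T * (B *ᵥ x2) i) :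
    ∃ V h b : Fin N → ℝ,
      (∀ i, |x2 i - 1| ≤ δ) ∧
      (∀ i, |T * (B *ᵥ x2) i| ≤ 4 * δ) ∧
      (∀ i, |V i - 1| ≤ 3 * δ) ∧
      (∀ i, |x i + T * (B *ᵥ x2) i / 2 - 1| ≤ 3 * δ) ∧
      (∀ i, V i - T * (B *ᵥ V) i = x i - T * (B *ᵥ x2) i / 2) ∧
      (∀ i, T * (B *ᵥ V) i = h i - (α + 1 / 2) * b i) ∧
      (∀ i, b i = T * (B *ᵥ h) i) ∧
      (∃ q : Fin N → ℝ, h = T • (B *ᵥ q)) ∧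
      (∀ i, x i + T * (B *ᵥ x2) i / 2 = V i + (α - 1 / 2) * b i) ∧
      (∀ i, |T * (B *ᵥ x2) i| ≤ T * ‖B *ᵥ V‖) ∧
      (∀ i, (α + 1 / 2) * |b i| ≤ 2 * (T * ‖B *ᵥ V‖)) := by
  have hα0 : 0 < α := by linarith
  have hx2b := hB.abs_sub_one_le_of_eq (by positivity) hδ hx hx2
  -- One further resolvent makes everything a polynomial in `T B` applied to `q`: `x2 = q - h`, `T B
  -- x2 = h - b`, and `V = q - (α + 1/2) h`.
  obtain ⟨q, hq⟩ := hB.exists_resolvent hT.le x2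
  let h : Fin N → ℝ := T • (B *ᵥ q)
  let b : Fin N → ℝ := T • (B *ᵥ h)
  let V : Fin N → ℝ := q - (α + 1 / 2) • h
  have hh : ∀ i, h i = T * (B *ᵥ q) i := fun i => rfl
  have hb : ∀ i, b i = T * (B *ᵥ h) i := fun i => rfl
  have hVi : ∀ i, V i = q i - (α + 1 / 2) * h i := fun i => rfl
  have hx2q : x2 = q - h := by
    ext i
    simp only [Pi.sub_apply, hh]
    linarith [hq i]
  have hBx2 : ∀ i, T * (B *ᵥ x2) i = h i - b i := by
    intro i
    rw [hx2q, Matrix.mulVec_sub, Pi.sub_apply, mul_sub, hh, hb]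
  have hBV : ∀ i, T * (B *ᵥ V) i = h i - (α + 1 / 2) * b i := by
    intro i
    simp only [V, Matrix.mulVec_sub, Matrix.mulVec_smul, Pi.sub_apply, Pi.smul_apply, smul_eq_mul,
      hh, hb]
    ring
  have ha4 : ∀ i, |T * (B *ᵥ x2) i| ≤ 4 * δ := by
    intro i
    have h1 : |α * (T * (B *ᵥ x2) i)| ≤ 2 * δ := by
      have : α * (T * (B *ᵥ x2) i) = (x2 i - 1) - (x i - 1) := by linarith [hx2 i]
      rw [this]
      exact (abs_sub _ _).trans (by linarith [hx2b i, hx i])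
    rw [abs_mul, abs_of_pos hα0] at h1
    nlinarith [abs_nonneg (T * (B *ᵥ x2) i)]
  have hVeq : ∀ i, V i - T * (B *ᵥ V) i = x i - T * (B *ᵥ x2) i / 2 := by
    intro i
    have h1 := hx2 i
    rw [mul_assoc, hBx2, hx2q, Pi.sub_apply] at h1
    rw [hBV, hBx2, hVi]
    linarith
  have hxa : ∀ s : ℝ, |s| = 1 → ∀ i, |x i + s * (T * (B *ᵥ x2) i) / 2 - 1| ≤ 3 * δ := by
    intro s hs i
    have : x i + s * (T * (B *ᵥ x2) i) / 2 - 1 = (x i - 1) + s * (T * (B *ᵥ x2) i) / 2 := by ring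
    rw [this]
    refine (abs_add_le _ _).trans ?_
    rw [abs_div, abs_mul, hs, abs_two]
    linarith [hx i, ha4 i]
  have hM : ∀ i, |T * (B *ᵥ V) i| ≤ T * ‖B *ᵥ V‖ := by
    intro i
    rw [abs_mul, abs_of_pos hT]
    exact mul_le_mul_of_nonneg_left (norm_le_pi_norm (B *ᵥ V) i) hT.le
  have hM0 : 0 ≤ T * ‖B *ᵥ V‖ := by positivity
  -- Since `h = T B V + (α + 1/2) T B h`, the maximum principle bounds `h` independently of `α` and
  -- `T`.
  have hhM : ∀ i, |h i| ≤ T * ‖B *ᵥ V‖ := by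
    refine hB.abs_le_of_eq (T := (α + 1 / 2) * T) (d := fun _ => 1)
      (f := fun i => T * (B *ᵥ V) i) (by positivity) one_pos hM0 (fun _ => le_rfl)
      (fun i => by rw [one_mul]; exact hM i) fun i => ?_
    have := hBV i
    rw [hb] at this
    linarith
  have hκ : 0 < α + 1 / 2 := by linarith
  refine ⟨V, h, b, hx2b, ha4, ?_, ?_, hVeq, hBV, hb, ⟨q, rfl⟩, ?_, ?_, ?_⟩
  · refine hB.abs_sub_one_le_of_eq hT.le (by linarith) (hxa (-1) (by simp)) fun i => ?_
    linarith [hVeq i]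
  · intro i
    have := hxa 1 (by simp) i
    rwa [one_mul] at this
  · intro i
    have h1 := hVeq i
    rw [hBV, hBx2] at h1
    rw [hBx2]
    linarith
  · intro i
    have h1 : (α + 1 / 2) * (T * (B *ᵥ x2) i) = (α - 1 / 2) * h i + T * (B *ᵥ V) i := by
      rw [hBx2, hBV]; ring
    have h2 : (α + 1 / 2) * |T * (B *ᵥ x2) i| ≤ (α + 1 / 2) * (T * ‖B *ᵥ V‖) := by
      rw [← abs_of_pos hκ, ← abs_mul, abs_of_pos hκ, h1]
      refine (abs_add_le _ _).trans ?_
      rw [abs_mul, abs_of_nonneg (by linarith : 0 ≤ α - 1 / 2)]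
      have := mul_le_mul_of_nonneg_left (hhM i) (by linarith : 0 ≤ α - 1 / 2)
      linarith [hM i]
    exact le_of_mul_le_mul_left h2 hκ
  · intro i
    have h1 : (α + 1 / 2) * b i = h i - T * (B *ᵥ V) i := by rw [hBV]; ring
    rw [← abs_of_pos hκ, ← abs_mul, h1]
    exact (abs_sub _ _).trans (by linarith [hhM i, hM i])

/-- The remainders of the one-step expansion are dominated by the dissipation. -/
theorem remainder_le_dissipation {α T M β C : ℝ} (hα : 1 / 2 ≤ α) (hT : 0 < T) (hβ : 0 ≤ β)
    (hC : 0 < C) (hM : 0 ≤ M) (hMβ : M ≤ C * β / T + (α + 1 / 2) * β)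
    (hβM : (α + 1 / 2) * β ≤ 2 * M) :
    (α - 1 / 2) * β * M + (1 - 1 / (2 * α)) * M ^ 2
      ≤ (2 * (C + 1) ^ 2 + (C + 1) + 3) * (M ^ 2 / T + (α - 1 / 2) * (α + 1 / 2) * β ^ 2) := by
  have hα0 : 0 < α := by linarith
  have hμ : 0 ≤ α - 1 / 2 := by linarith
  have hs0 : 0 ≤ 1 - 1 / (2 * α) := by
    rw [sub_nonneg, div_le_one (by linarith)]; linarith
  have hs1 : 1 - 1 / (2 * α) ≤ 1 := by
    have : 0 < 1 / (2 * α) := by positivity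
    linarith
  have hs2 : (1 - 1 / (2 * α)) * (α + 1 / 2) ≤ 2 * (α - 1 / 2) := by
    have : (1 - 1 / (2 * α)) * (α + 1 / 2) = (α - 1 / 2) * ((α + 1 / 2) / α) := by
      field_simp
    rw [this, mul_comm 2]
    refine mul_le_mul_of_nonneg_left ?_ hμ
    rw [div_le_iff₀ hα0]
    linarith
  have hW : 0 ≤ (α - 1 / 2) * (α + 1 / 2) * β ^ 2 := by positivity
  have hMT : 0 ≤ M ^ 2 / T := by positivity
  -- For `T ≥ 1`, `M` is bounded by a multiple of `(α + 1/2) β` and the second dissipation absorbs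
  -- everything; for `T ≤ 1`, `M²` is at most `M² / T`.
  rcases le_total 1 T with h1 | h1
  · have hM1 : M ≤ (C + 1) * ((α + 1 / 2) * β) := by
      have h2 : C * β / T ≤ C * β := div_le_self (by positivity) h1
      have h3 : C * β ≤ C * ((α + 1 / 2) * β) :=
        mul_le_mul_of_nonneg_left (by nlinarith) hC.le
      linarith
    have e1 : (α - 1 / 2) * β * M ≤ (C + 1) * ((α - 1 / 2) * (α + 1 / 2) * β ^ 2) := by
      calc (α - 1 / 2) * β * M ≤ (α - 1 / 2) * β * ((C + 1) * ((α + 1 / 2) * β)) := by gcongr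
        _ = _ := by ring
    have e2 : (1 - 1 / (2 * α)) * M ^ 2
        ≤ 2 * (C + 1) ^ 2 * ((α - 1 / 2) * (α + 1 / 2) * β ^ 2) := by
      calc (1 - 1 / (2 * α)) * M ^ 2
          ≤ (1 - 1 / (2 * α)) * ((C + 1) * ((α + 1 / 2) * β)) ^ 2 := by gcongr
        _ = ((1 - 1 / (2 * α)) * (α + 1 / 2)) * ((C + 1) ^ 2 * (α + 1 / 2) * β ^ 2) := by ring
        _ ≤ (2 * (α - 1 / 2)) * ((C + 1) ^ 2 * (α + 1 / 2) * β ^ 2) := by gcongr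
        _ = _ := by ring
    have e3 : 0 ≤ (2 * (C + 1) ^ 2 + (C + 1) + 3) * (M ^ 2 / T) := by positivity
    linarith
  · have e0 : M ^ 2 ≤ M ^ 2 / T := le_div_self (by positivity) hT h1
    have e1 : (α - 1 / 2) * β * M ≤ 2 * M ^ 2 := by nlinarith
    have e2 : (1 - 1 / (2 * α)) * M ^ 2 ≤ 1 * M ^ 2 := by gcongr
    have e3 : 0 ≤ (2 * (C + 1) ^ 2 + (C + 1) + 3) * ((α - 1 / 2) * (α + 1 / 2) * β ^ 2) := by
      positivity
    have e4 : 0 ≤ (2 * (C + 1) ^ 2 + (C + 1)) * (M ^ 2 / T) := by positivity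
    linarith

end IsStationaryGenerator

namespace IsStationaryGenerator

variable {N : ℕ} {B : Matrix (Fin N) (Fin N) ℝ} {p : Fin N → ℝ}

/-- The difference `e` between the weighted new value `v` and its linear approximation `V` is of
higher order. -/
theorem abs_error_le (hB : IsStationaryGenerator B p) {T α δ M : ℝ} (hT : 0 < T)
    (hα : 1 / 2 ≤ α) (hδ : δ ≤ 1 / 100) (hM0 : 0 ≤ M) (hM : M ≤ 6 * δ) {x x2 v V : Fin N → ℝ}
    (hx : ∀ i, |x i - 1| ≤ δ) (hx2b : ∀ i, |x2 i - 1| ≤ δ)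
    (hx2 : ∀ i, x2 i = x i + α * T * (B *ᵥ x2) i)
    (hv : ∀ i, v i = patankarWeight α (x i) (x2 i) * (x i + T * (B *ᵥ v) i))
    (ha4 : ∀ i, |T * (B *ᵥ x2) i| ≤ 4 * δ) (hV : ∀ i, |V i - 1| ≤ 3 * δ)
    (hVeq : ∀ i, V i - T * (B *ᵥ V) i = x i - T * (B *ᵥ x2) i / 2)
    (haM : ∀ i, |T * (B *ᵥ x2) i| ≤ M) :
    (∀ i, |x i + T * (B *ᵥ x2) i / 2 - x i * (patankarWeight α (x i) (x2 i))⁻¹|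
      ≤ 6 * δ * (1 - 1 / (2 * α)) * M) ∧
    (∀ i, |(v - V) i| ≤ 10 * δ * M) ∧ (∀ i, |T * (B *ᵥ (v - V)) i| ≤ 20 * δ * M) := by
  rcases isEmpty_or_nonempty (Fin N) with hN | ⟨⟨i0⟩⟩
  · exact ⟨fun i => hN.elim i, fun i => hN.elim i, fun i => hN.elim i⟩
  have hδ0 : 0 ≤ δ := (abs_nonneg _).trans (hx i0)
  have hα0 : 0 < α := by linarith
  have hs0 : 0 ≤ 1 - 1 / (2 * α) := by
    rw [sub_nonneg, div_le_one (by linarith)]; linarith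
  have hs1 : 1 - 1 / (2 * α) ≤ 1 := by
    have : 0 < 1 / (2 * α) := by positivity
    linarith
  have hd0 : ∀ i, |x i + T * (B *ᵥ x2) i / 2 - x i * (patankarWeight α (x i) (x2 i))⁻¹|
      ≤ 6 * δ * (1 - 1 / (2 * α)) * |T * (B *ᵥ x2) i| := fun i =>
    abs_sub_div_patankarWeight_le hα hδ (hx i) (hx2b i) (by linarith [hx2 i])
  have hw : ∀ i, 0 < patankarWeight α (x i) (x2 i) := fun i =>
    patankarWeight_pos hα (by linarith [(abs_le.1 (hx i)).1])
      (by linarith [(abs_le.1 (hx2b i)).1])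
  set d : Fin N → ℝ := fun i => (patankarWeight α (x i) (x2 i))⁻¹ with hd
  let f : Fin N → ℝ := fun i => (1 - d i) * V i + T * (B *ᵥ x2) i / 2
  have hsrc := fun i => abs_source_le hδ (hx i) (hV i) (ha4 i) hs1 (hd0 i)
  have hf : ∀ i, |f i| ≤ 9 * δ * M := fun i =>
    (hsrc i).2.2.trans (mul_le_mul_of_nonneg_left (haM i) (by linarith))
  -- This is `d v = x + T B v` minus the linear equation `V - T B V = x - T B x2 / 2`.
  have heq : ∀ i, d i * (v - V) i = f i + T * (B *ᵥ (v - V)) i := by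
    intro i
    have h1 : d i * v i = x i + T * (B *ᵥ v) i := by
      simp only [hd]
      conv_lhs => rw [hv i]
      rw [← mul_assoc, inv_mul_cancel₀ (hw i).ne', one_mul]
    simp only [f, Matrix.mulVec_sub, Pi.sub_apply]
    linarith [hVeq i]
  -- Maximum principle with source `9 δ M` and `d ≥ 9/10`. The bound on `T B e = d e - f` is then
  -- `11 δ M + 9 δ M`.
  have he : ∀ i, |(v - V) i| ≤ 10 * δ * M :=
    hB.abs_le_of_eq hT.le (c := 9 / 10) (by norm_num) (by positivity) (fun i => (hsrc i).1)
      (fun i => (hf i).trans (by linarith)) heq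
  refine ⟨fun i => (hd0 i).trans ?_, he, fun i => ?_⟩
  · exact mul_le_mul_of_nonneg_left (haM i) (by positivity)
  · have h1 : T * (B *ᵥ (v - V)) i = d i * (v - V) i - f i := by linarith [heq i]
    have h2 : 0 < d i := by linarith [(hsrc i).1]
    rw [h1]
    refine (abs_sub _ _).trans ?_
    rw [abs_mul, abs_of_pos h2]
    have := mul_le_mul (hsrc i).2.1 (he i) (abs_nonneg _) (by norm_num)
    linarith [hf i]

theorem abs_mul_le_mul_norm {T : ℝ} (hT : 0 < T) (u : Fin N → ℝ) (i : Fin N) :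
    |T * u i| ≤ T * ‖u‖ := by
  rw [abs_mul, abs_of_pos hT]
  exact mul_le_mul_of_nonneg_left (norm_le_pi_norm u i) hT.le

theorem abs_le_div_of_abs_mul_le {T c r : ℝ} (hT : 0 < T) (h : |T * r| ≤ c) : |r| ≤ c / T := by
  rwa [le_div_iff₀' hT, ← abs_of_pos hT, ← abs_mul]

theorem mul_norm_le_of_abs_mul_le {T c : ℝ} (hT : 0 < T) (hc : 0 ≤ c) {u : Fin N → ℝ}
    (h : ∀ i, |T * u i| ≤ c) : T * ‖u‖ ≤ c := by
  rw [← le_div_iff₀' hT]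
  exact (pi_norm_le_iff_of_nonneg (by positivity)).2 fun i => abs_le_div_of_abs_mul_le hT (h i)

/-- Here `h = T B q` and `b = T² B (B q)`, so semisimplicity of the eigenvalue `0` gives `|h| ≤ C
‖b‖ / T`. -/
theorem mul_norm_mulVec_le (hsq : ∃ C > 0, ∀ u : Fin N → ℝ, ‖B *ᵥ u‖ ≤ C * ‖B *ᵥ (B *ᵥ u)‖) :
    ∃ C > 0, ∀ T > 0, ∀ κ > 0, ∀ V h b q : Fin N → ℝ, h = T • (B *ᵥ q) →
      (∀ i, b i = T * (B *ᵥ h) i) → (∀ i, T * (B *ᵥ V) i = h i - κ * b i) →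
      T * ‖B *ᵥ V‖ ≤ C * ‖b‖ / T + κ * ‖b‖ := by
  obtain ⟨C, hC, hsq⟩ := hsq
  refine ⟨C, hC, fun T hT κ hκ V h b q hhq hb hBV => ?_⟩
  have h1 : ∀ i, |h i| ≤ C * ‖b‖ / T := by
    intro i
    have h2 : T * T * ‖B *ᵥ (B *ᵥ q)‖ = ‖b‖ := by
      have : b = (T * T) • (B *ᵥ (B *ᵥ q)) := by
        ext i
        rw [hb, hhq, Matrix.mulVec_smul]
        simp [mul_assoc]
      rw [this, norm_smul, Real.norm_of_nonneg (by positivity)]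
    have h3 : |h i| ≤ T * ‖B *ᵥ q‖ := by
      rw [hhq]
      exact abs_mul_le_mul_norm hT _ i
    have h4 := mul_le_mul_of_nonneg_left (hsq q) hT.le
    rw [← h2]
    refine (h3.trans h4).trans (le_of_eq ?_)
    field_simp
  refine mul_norm_le_of_abs_mul_le hT (by positivity) fun i => ?_
  rw [hBV]
  refine (abs_sub _ _).trans (add_le_add (h1 i) ?_)
  rw [abs_mul, abs_of_pos hκ]
  exact mul_le_mul_of_nonneg_left (norm_le_pi_norm b i) hκ.le

/-- Half of the dissipation `2 k D`, together with all of `ρ W`, pays for the remainders; the other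
half is the decay. -/
theorem dissipation_dominates {S G C4 L δ k ρ D W t0 t1 t2 t3 t4 t5 : ℝ}
    (hL : L = 160 * S * G + 60 * S * C4 + 1) (hS : 0 ≤ S) (hG : 0 ≤ G) (hδ : 0 ≤ δ)
    (hδ1 : L * δ ≤ k) (hδ2 : L * δ ≤ ρ) (hD : 0 ≤ D) (hW : 0 ≤ W)
    (h : t0 ≤ -t1 + t2 - t3 + t4 + t5) (h1 : 2 * k * D ≤ t1) (h2 : t2 ≤ 60 * S * G * δ * D)
    (h3 : -t3 ≤ 100 * S * G * δ * D) (h4 : t4 ≤ -(ρ * W))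
    (h5 : t5 ≤ 60 * S * C4 * δ * (D + W)) : t0 ≤ -(k * D) := by
  have f1 : L * δ * D ≤ k * D := mul_le_mul_of_nonneg_right hδ1 hD
  have f2 : L * δ * W ≤ ρ * W := mul_le_mul_of_nonneg_right hδ2 hW
  have f3 : 0 ≤ S * G * δ * W := by positivity
  have f4 : 0 ≤ δ * D := by positivity
  have f5 : 0 ≤ δ * W := by positivity
  rw [hL] at f1 f2
  linarith

theorem sum_mul_le_add_of_pointwise {p D Q : Fin N → ℝ} (hp : ∀ i, 0 < p i)
    {c : ℝ} (h : ∀ i, D i ≤ Q i + c) :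
    ∑ i, p i * D i ≤ ∑ i, p i * Q i + (∑ i, p i) * c := by
  rw [Finset.sum_mul, ← Finset.sum_add_distrib]
  refine Finset.sum_le_sum fun i _ => ?_
  have := mul_le_mul_of_nonneg_left (h i) (hp i).le
  linarith

-- The radius `δ` and the rate `c` are fixed before `T` and `α`. This yields a single neighbourhood
-- for all step sizes and all `α`.
set_option maxHeartbeats 800000 in
theorem exists_decay (hB : IsStationaryGenerator B p) :
    ∃ δ > 0, δ ≤ 1 / 100 ∧ ∃ c > 0, ∀ T > 0, ∀ α : ℝ, 1 / 2 ≤ α → ∀ x x2 v : Fin N → ℝ,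
      (∀ i, |x i - 1| ≤ δ) → (∀ i, x2 i = x i + α * T * (B *ᵥ x2) i) →
      (∀ i, v i = patankarWeight α (x i) (x2 i) * (x i + T * (B *ᵥ v) i)) →
      (∀ i, 0 < x i + T * (B *ᵥ v) i) →
      ∑ i, p i * (1 / (x i + T * (B *ᵥ v) i) - 1 / x i) ≤ -(c * T * ‖B *ᵥ x2‖ ^ 2) := by
  obtain ⟨G, hG, hrep⟩ := hB.exists_abs_sub_classRep_le
  obtain ⟨K, hK, hdir⟩ := hB.exists_norm_sq_le_dirichletSum
  obtain ⟨C, hC, hsq⟩ := mul_norm_mulVec_le hB.exists_norm_mulVec_le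
  obtain ⟨ρ, hρ, hρb⟩ := exists_mul_norm_sq_le_sum hB.pos
  set S := ∑ i, p i with hS
  have hS0 : 0 ≤ S := Finset.sum_nonneg fun i _ => (hB.pos i).le
  set C4 := 2 * (C + 1) ^ 2 + (C + 1) + 3 with hC4
  have hC40 : 0 < C4 := by positivity
  -- `160 = 60 + 100` collects the two terms estimated by class variation; `60 * S * C4` comes from
  -- the pointwise remainder.
  set L := 160 * S * G + 60 * S * C4 + 1 with hL
  have hL0 : 0 < L := by positivity
  refine ⟨min (1 / 100) (min (1 / (8 * K * L)) (ρ / L)), by positivity, min_le_left _ _,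
    1 / (8 * K), by positivity, ?_⟩
  set δ := min (1 / 100) (min (1 / (8 * K * L)) (ρ / L)) with hδdef
  have hδ0 : 0 < δ := by positivity
  have hδ : δ ≤ 1 / 100 := min_le_left _ _
  have hδ1 : L * δ ≤ 1 / (8 * K) := by
    have : δ ≤ 1 / (8 * K * L) := (min_le_right _ _).trans (min_le_left _ _)
    calc L * δ ≤ L * (1 / (8 * K * L)) := by gcongr
      _ = _ := by field_simp
  have hδ2 : L * δ ≤ ρ := by
    have : δ ≤ ρ / L := (min_le_right _ _).trans (min_le_right _ _)
    calc L * δ ≤ L * (ρ / L) := by gcongr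
      _ = _ := by field_simp
  clear_value δ
  intro T hT α hα x x2 v hx hx2 hv hx1
  obtain ⟨V, h, b, hx2b, ha4, hV, hX, hVeq, hBV, hb, ⟨q, hhq⟩, hXV, haM, hbM⟩ :=
    hB.exists_linear_stage hT hα hx hδ0.le hx2
  set M := T * ‖B *ᵥ V‖ with hMdef
  have hM0 : 0 ≤ M := by positivity
  have hNM : ∀ i, |T * (B *ᵥ V) i| ≤ M := abs_mul_le_mul_norm hT _
  have hM6 : M ≤ 6 * δ := by
    refine mul_norm_le_of_abs_mul_le hT (by positivity) fun i => ?_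
    have : T * (B *ᵥ V) i = (V i - 1) - (x i - 1) + T * (B *ᵥ x2) i / 2 := by
      linarith [hVeq i]
    rw [this]
    refine (abs_add_le _ _).trans ?_
    have h2 := abs_sub (V i - 1) (x i - 1)
    rw [abs_div, abs_two]
    linarith [hV i, hx i, ha4 i]
  obtain ⟨hZ, he, hBe⟩ := hB.abs_error_le hT hα hδ hM0 hM6 hx hx2b hx2 hv ha4 hV hVeq haM
  set e := v - V with hedef
  set μ := α - 1 / 2 with hμdef
  set s := 1 - 1 / (2 * α) with hsdef
  have hα0 : 0 < α := by linarith
  have hμ : 0 ≤ μ := by linarith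
  have hs0 : 0 ≤ s := by
    rw [hsdef, sub_nonneg, div_le_one (by linarith)]; linarith
  have hs1 : s ≤ 1 := by
    have : 0 < 1 / (2 * α) := by positivity
    linarith
  have hve : ∀ i, v i = V i + e i := fun i => by simp [hedef]
  have heδ : ∀ i, |e i| ≤ δ := fun i => (he i).trans (by nlinarith)
  have hv4 : ∀ i, |v i - 1| ≤ 4 * δ := by
    intro i
    have : v i - 1 = (V i - 1) + e i := by linarith [hve i]
    rw [this]
    exact (abs_add_le _ _).trans (by linarith [hV i, heδ i])
  set β := ‖b‖ with hβ
  have hbβ : ∀ i, |b i| ≤ β := fun i => norm_le_pi_norm b i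
  have hβ0 : 0 ≤ β := norm_nonneg b
  have hw : ∀ i, 0 < patankarWeight α (x i) (x2 i) := fun i =>
    patankarWeight_pos hα (by linarith [(abs_le.1 (hx i)).1])
      (by linarith [(abs_le.1 (hx2b i)).1])
  -- pointwise expansion
  have hpt : ∀ i, 1 / (x i + T * (B *ᵥ v) i) - 1 / x i
      ≤ (-(T * (B *ᵥ V) i * (1 / V i ^ 2)) + T * (B *ᵥ V) i * (e i / (v i * V i ^ 2))
          - T * (B *ᵥ e) i * (1 / (v i * V i)) + μ * (T * (B *ᵥ V) i * b i))
        + 60 * δ * (μ * β * M + s * M ^ 2) := by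
    intro i
    have hx0 : 0 < x i := by linarith [(abs_le.1 (hx i)).1]
    have h1 := abs_inv_sub_inv_expansion_le (x := x i) (x1 := x i + T * (B *ᵥ v) i) (v := v i)
      (V := V i) (e := e i) (Z := x i * (patankarWeight α (x i) (x2 i))⁻¹)
      (P := T * (B *ᵥ V) i) (E := T * (B *ᵥ e) i) (μ := μ) (b := b i) (M := M) (s := s)
      hδ hx0 (hx1 i)
      (by simp only [hedef, Matrix.mulVec_sub, Pi.sub_apply]; ring)
      (by
        have h2 := (hw i).ne'
        conv_rhs => rw [hv i]
        field_simp)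
      (hve i) (hv4 i) (hV i) (by rw [← hXV]; exact hX i) (hNM i) (hBe i) hμ hs0 hs1 hM6
      (by rw [← hXV]; exact hZ i)
    refine h1.trans ?_
    have h2 : μ * |b i| * M ≤ μ * β * M := by
      gcongr
      exact hbβ i
    have h3 := mul_le_mul_of_nonneg_left h2 (by positivity : 0 ≤ 60 * δ)
    linarith
  have hsum := sum_mul_le_add_of_pointwise hB.pos hpt
  -- the dissipation
  have t1 : M ^ 2 / (4 * K * T) ≤ T * ∑ i, p i * ((B *ᵥ V) i * (1 / V i ^ 2)) := by
    have h1 := hB.dirichletSum_le_sum_div_sq (V := V)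
      (fun i => by linarith [(abs_le.1 (hV i)).1]) (fun i => by linarith [(abs_le.1 (hV i)).2])
    have h2 := hdir V
    have h3 : ‖B *ᵥ V‖ ^ 2 / (4 * K) ≤ ∑ i, p i * ((B *ᵥ V) i * (1 / V i ^ 2)) := by
      refine le_trans ?_ h1
      rw [div_le_div_iff₀ (by positivity) (by norm_num)]
      linarith
    calc M ^ 2 / (4 * K * T) = T * (‖B *ᵥ V‖ ^ 2 / (4 * K)) := by
          rw [hMdef]; field_simp
      _ ≤ _ := by gcongr
  -- variation over communicating classes
  set Y := G * (M / T) with hY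
  have hY0 : 0 ≤ Y := by positivity
  have hVY : ∀ i, |V i - V (classRep B i)| ≤ Y := by
    intro i
    have : M / T = ‖B *ᵥ V‖ := by rw [hMdef]; field_simp
    rw [hY, this]
    exact hrep V i
  have hBen : ‖B *ᵥ e‖ ≤ 20 * δ * (M / T) := by
    refine (pi_norm_le_iff_of_nonneg (by positivity)).2 fun i => ?_
    have h1 := hBe i
    rw [abs_mul, abs_of_pos hT] at h1
    rw [← mul_div_assoc, le_div_iff₀ hT, mul_comm]
    exact h1
  have heY : ∀ i, |e i - e (classRep B i)| ≤ 20 * δ * Y := by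
    intro i
    refine (hrep e i).trans ?_
    have := mul_le_mul_of_nonneg_left hBen hG.le
    rw [hY]
    linarith
  have hvar : ∀ i, |e i / (v i * V i ^ 2) - e (classRep B i)
        / (v (classRep B i) * V (classRep B i) ^ 2)| ≤ 60 * δ * Y ∧
      |1 / (v i * V i) - 1 / (v (classRep B i) * V (classRep B i))| ≤ 5 * Y := by
    intro i
    refine abs_div_sub_div_le hδ hY0 (hv4 i) (hv4 _) (hV i) (hV _) (heδ _) (heY i) ?_ (hVY i)
    have : v i - v (classRep B i)
        = (V i - V (classRep B i)) + (e i - e (classRep B i)) := by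
      rw [hve i, hve (classRep B i)]; ring
    rw [this]
    refine (abs_add_le _ _).trans ?_
    have h1 := heY i
    have h2 : 20 * δ * Y ≤ Y := by nlinarith
    linarith [hVY i]
  have t2 := hB.abs_sum_mulVec_mul_le (u := V) (g := fun i => e i / (v i * V i ^ 2))
    (b := M / T) (K := 60 * δ * Y)
    (fun i => abs_le_div_of_abs_mul_le hT (hNM i))
    (fun i => (hvar i).1)
  have t3 := hB.abs_sum_mulVec_mul_le (u := e) (g := fun i => 1 / (v i * V i))
    (b := 20 * δ * M / T) (K := 5 * Y)
    (fun i => abs_le_div_of_abs_mul_le hT (hBe i))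
    (fun i => (hvar i).2)
  -- the quadratic term in `b`
  have t4 : ∑ i, p i * (T * (B *ᵥ V) i * b i) ≤ -((α + 1 / 2) * (ρ * β ^ 2)) := by
    -- From `T B V = h - (α + 1/2) b` and `b = T B h`: the cross term `h b` is the nonpositive form
    -- `T (B h) h`.
    have h1 : ∑ i, p i * (T * (B *ᵥ V) i * b i)
        = T * ∑ i, p i * ((B *ᵥ h) i * h i) - (α + 1 / 2) * ∑ i, p i * (b i * b i) := by
      rw [Finset.mul_sum, Finset.mul_sum, ← Finset.sum_sub_distrib]
      refine Finset.sum_congr rfl fun i _ => ?_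
      rw [hBV]
      have := hb i
      linear_combination (p i * h i) * this
    rw [h1]
    have h2 := mul_nonpos_of_nonneg_of_nonpos hT.le (hB.sum_mul_mulVec_self_nonpos h)
    have h3 := mul_le_mul_of_nonneg_left (hρb b) (by linarith : 0 ≤ α + 1 / 2)
    linarith
  -- control of the remainders
  have hMβ : M ≤ C * β / T + (α + 1 / 2) * β :=
    hsq T hT (α + 1 / 2) (by linarith) V h b q hhq hb hBV
  have hβM : (α + 1 / 2) * β ≤ 2 * M := by
    rw [mul_comm, ← le_div_iff₀ (by linarith)]
    refine (pi_norm_le_iff_of_nonneg (div_nonneg (by linarith) (by linarith))).2 fun i => ?_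
    rw [le_div_iff₀ (by linarith), mul_comm]
    exact hbM i
  have hrem := remainder_le_dissipation hα hT hβ0 hC hM0 hMβ hβM
  -- summing up
  have hsplit : ∑ i, p i * (-(T * (B *ᵥ V) i * (1 / V i ^ 2))
        + T * (B *ᵥ V) i * (e i / (v i * V i ^ 2))
        - T * (B *ᵥ e) i * (1 / (v i * V i)) + μ * (T * (B *ᵥ V) i * b i))
      = -(T * ∑ i, p i * ((B *ᵥ V) i * (1 / V i ^ 2)))
        + T * ∑ i, p i * ((B *ᵥ V) i * (e i / (v i * V i ^ 2)))
        - T * ∑ i, p i * ((B *ᵥ e) i * (1 / (v i * V i)))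
        + μ * ∑ i, p i * (T * (B *ᵥ V) i * b i) := by
    simp only [Finset.mul_sum, ← Finset.sum_neg_distrib, ← Finset.sum_add_distrib,
      ← Finset.sum_sub_distrib]
    exact Finset.sum_congr rfl fun i _ => by ring
  have hT2 : T * ∑ i, p i * ((B *ᵥ V) i * (e i / (v i * V i ^ 2)))
      ≤ 60 * S * G * δ * (M ^ 2 / T) := by
    calc _ ≤ T * (S * (M / T * (60 * δ * Y))) := by
          gcongr; exact (abs_le.1 t2).2
      _ = _ := by rw [hY]; field_simp
  have hT3 : -(T * ∑ i, p i * ((B *ᵥ e) i * (1 / (v i * V i))))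
      ≤ 100 * S * G * δ * (M ^ 2 / T) := by
    have h1 := (abs_le.1 t3).1
    calc _ = T * -(∑ i, p i * ((B *ᵥ e) i * (1 / (v i * V i)))) := by ring
      _ ≤ T * (S * (20 * δ * M / T * (5 * Y))) := by
          gcongr; linarith
      _ = _ := by rw [hY]; field_simp; ring
  have hT4 := mul_le_mul_of_nonneg_left t4 hμ
  set D := M ^ 2 / T with hD
  set W := μ * (α + 1 / 2) * β ^ 2 with hW
  have hD0 : 0 ≤ D := by positivity
  have hW0 : 0 ≤ W := by positivity
  have hT5 : S * (60 * δ * (μ * β * M + s * M ^ 2)) ≤ 60 * S * C4 * δ * (D + W) := by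
    calc _ ≤ S * (60 * δ * (C4 * (D + W))) := by gcongr
      _ = _ := by ring
  have hmain : ∑ i, p i * (1 / (x i + T * (B *ᵥ v) i) - 1 / x i) ≤ -(1 / (8 * K) * D) := by
    rw [hsplit] at hsum
    refine dissipation_dominates hL hS0 hG.le hδ0.le hδ1 hδ2 hD0 hW0 hsum
      (le_trans (le_of_eq ?_) t1) hT2 hT3 (hT4.trans (le_of_eq ?_)) hT5
    · rw [hD]; field_simp; ring
    · rw [hW]; ring
  refine hmain.trans (neg_le_neg ?_)
  have hfinal : T * ‖B *ᵥ x2‖ ≤ M := mul_norm_le_of_abs_mul_le hT hM0 haM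
  calc 1 / (8 * K) * T * ‖B *ᵥ x2‖ ^ 2 = 1 / (8 * K) * ((T * ‖B *ᵥ x2‖) ^ 2 / T) := by
        field_simp
    _ ≤ 1 / (8 * K) * D := by rw [hD]; gcongr

end IsStationaryGenerator

/-! ### The iteration near a positive steady state -/

/-- The generator obtained from a conservative Metzler matrix by scaling with a positive steady
state `p`. -/
noncomputable def scaledGenerator {N : ℕ} (Λ : Matrix (Fin N) (Fin N) ℝ) (p : Fin N → ℝ) :
    Matrix (Fin N) (Fin N) ℝ :=
  Matrix.of fun i j => Λ i j * p j / p i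

theorem scaledGenerator_mulVec {N : ℕ} (Λ : Matrix (Fin N) (Fin N) ℝ) (p u : Fin N → ℝ)
    (i : Fin N) : (scaledGenerator Λ p *ᵥ u) i = (Λ *ᵥ (p * u)) i / p i := by
  simp only [scaledGenerator, Matrix.mulVec, dotProduct, Matrix.of_apply, Pi.mul_apply,
    Finset.sum_div]
  exact Finset.sum_congr rfl fun j _ => by ring

theorem isStationaryGenerator_scaledGenerator {N : ℕ} {Λ : Matrix (Fin N) (Fin N) ℝ}
    {p : Fin N → ℝ} (hoff : ∀ i j, i ≠ j → 0 ≤ Λ i j) (hΛ : IsConservative Λ)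
    (hp : p ∈ positiveOrthant N) (hp0 : Λ *ᵥ p = 0) :
    IsStationaryGenerator (scaledGenerator Λ p) p where
  pos := hp
  offDiag i j hij := div_nonneg (mul_nonneg (hoff i j hij) (hp j).le) (hp i).le
  row_sum i := by
    have := congrFun hp0 i
    simp only [Matrix.mulVec, dotProduct, Pi.zero_apply] at this
    simp only [scaledGenerator, Matrix.of_apply, ← Finset.sum_div, this, zero_div]
  stationary j := by
    have : ∀ i, p i * scaledGenerator Λ p i j = Λ i j * p j := fun i => by
      have := (hp i).ne'
      simp only [scaledGenerator, Matrix.of_apply]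
      field_simp
    simp only [this, ← Finset.sum_mul, hΛ.sum_col, zero_mul]

/-- The Lyapunov function of the scheme with respect to the steady state `p`. -/
noncomputable def chiSqDist {N : ℕ} (p y : Fin N → ℝ) : ℝ :=
  ∑ i, (y i - p i) ^ 2 / y i

theorem chiSqDist_nonneg {N : ℕ} {p y : Fin N → ℝ} (hy : y ∈ positiveOrthant N) :
    0 ≤ chiSqDist p y :=
  Finset.sum_nonneg fun i _ => div_nonneg (sq_nonneg _) (hy i).le

theorem chiSqDist_self {N : ℕ} (p : Fin N → ℝ) : chiSqDist p p = 0 := by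
  simp [chiSqDist]

theorem norm_sub_lt_of_chiSqDist_lt {N : ℕ} {p : Fin N → ℝ} (hp : p ∈ positiveOrthant N) {ε : ℝ}
    (hε : 0 < ε) : ∃ η > 0, ∀ y ∈ positiveOrthant N, chiSqDist p y < η → ‖y - p‖ < ε := by
  -- At distance at least `ε` from `p i`, the function `(t - p i)² / t` is at least its value `ε² /
  -- (p i + ε)` at `p i + ε`.
  refine ⟨ε ^ 2 / (‖p‖ + ε), by positivity, fun y hy h => ?_⟩
  rw [pi_norm_lt_iff hε]
  intro i
  by_contra hi
  rw [not_lt, Real.norm_eq_abs, Pi.sub_apply] at hi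
  have h1 : (y i - p i) ^ 2 / y i ≤ chiSqDist p y :=
    Finset.single_le_sum (f := fun i => (y i - p i) ^ 2 / y i)
      (fun i _ => div_nonneg (sq_nonneg _) (hy i).le) (Finset.mem_univ i)
  have hpi : p i ≤ ‖p‖ := (le_abs_self _).trans (norm_le_pi_norm p i)
  have hp0 := hp i
  have hy0 := hy i
  have h2 : ε ^ 2 / (‖p‖ + ε) ≤ ε ^ 2 / (p i + ε) := by gcongr
  have h3 : ε ^ 2 / (p i + ε) ≤ (y i - p i) ^ 2 / y i := by
    rw [div_le_div_iff₀ (by linarith) hy0]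
    rcases le_abs.1 hi with h4 | h4
    · obtain ⟨t, ht⟩ : ∃ t, t = y i - p i - ε := ⟨_, rfl⟩
      have hyt : y i = p i + ε + t := by linarith
      have ht0 : 0 ≤ t := by linarith
      rw [hyt]
      have e1 : 0 ≤ (2 * ε * t + t ^ 2) * p i := by positivity
      have e2 : 0 ≤ ε * (ε * t + t ^ 2) := by positivity
      nlinarith
    · have e1 : ε ^ 2 ≤ (y i - p i) ^ 2 := by nlinarith
      exact mul_le_mul e1 (by linarith) hy0.le (sq_nonneg _)
  linarith

theorem chiSqDist_lt_of_norm_sub_lt {N : ℕ} {p : Fin N → ℝ} (hp : p ∈ positiveOrthant N) {η : ℝ}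
    (hη : 0 < η) : ∃ δ > 0, ∀ y : Fin N → ℝ, ‖y - p‖ < δ → chiSqDist p y < η := by
  have hc : ContinuousAt (chiSqDist p) p := by
    unfold chiSqDist
    refine tendsto_finsetSum _ fun i _ => ?_
    have : ContinuousAt (fun y : Fin N → ℝ => (y i - p i) ^ 2 / y i) p :=
      (((continuous_apply i).sub continuous_const).pow 2).continuousAt.div
        (continuous_apply i).continuousAt (hp i).ne'
    exact this
  have h1 := hc.eventually (gt_mem_nhds (by rw [chiSqDist_self]; exact hη))
  obtain ⟨δ, hδ, h⟩ := Metric.eventually_nhds_iff.1 h1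
  exact ⟨δ, hδ, fun y hy => h (by rwa [dist_eq_norm])⟩

theorem dotProduct_mprk22Map {N : ℕ} {Λ : Matrix (Fin N) (Fin N) ℝ}
    (hoff : ∀ i j, i ≠ j → 0 ≤ Λ i j) (hΛ : IsConservative Λ) {α Δt : ℝ} (hα : 1 / 2 ≤ α)
    (hΔt : 0 < Δt) {y : Fin N → ℝ} (hy : y ∈ positiveOrthant N) {v : Fin N → ℝ}
    (hv : Λᵀ *ᵥ v = 0) : v ⬝ᵥ mprk22Map Λ α Δt y = v ⬝ᵥ y := by
  obtain ⟨y2, h⟩ := isMPRK22Step_mprk22Map hoff hΛ hα hΔt hy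
  obtain ⟨-, h1⟩ := (isMPRK22Step_iff hΛ hy).1 h
  set w : Fin N → ℝ := fun ν => patankarWeight α (y ν) (y2 ν) * mprk22Map Λ α Δt y ν
  have h2 : mprk22Map Λ α Δt y = y + Δt • (Λ *ᵥ w) := by
    ext k
    exact h1 k
  rw [h2, dotProduct_add, dotProduct_smul, Matrix.dotProduct_mulVec, ← Matrix.mulVec_transpose, hv,
    zero_dotProduct, smul_zero, add_zero]

theorem mprk22Map_mem_positiveOrthant {N : ℕ} {Λ : Matrix (Fin N) (Fin N) ℝ}
    (hoff : ∀ i j, i ≠ j → 0 ≤ Λ i j) (hΛ : IsConservative Λ) {α Δt : ℝ} (hα : 1 / 2 ≤ α)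
    (hΔt : 0 < Δt) {y : Fin N → ℝ} (hy : y ∈ positiveOrthant N) :
    mprk22Map Λ α Δt y ∈ positiveOrthant N := by
  obtain ⟨y2, h⟩ := isMPRK22Step_mprk22Map hoff hΛ hα hΔt hy
  exact ((step_existsUnique_pos hoff hΛ hα hΔt hy).2 _ _ h).2

/-- Decay of the Lyapunov function in a neighbourhood of `p` that does not depend on the step size
and on `α`. -/
theorem exists_chiSqDist_decay {N : ℕ} {Λ : Matrix (Fin N) (Fin N) ℝ} {p : Fin N → ℝ}
    (hoff : ∀ i j, i ≠ j → 0 ≤ Λ i j) (hΛ : IsConservative Λ)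
    (hp : p ∈ positiveOrthant N) (hp0 : Λ *ᵥ p = 0) :
    ∃ δ > 0, ∀ Δt > 0, ∀ α : ℝ, 1 / 2 ≤ α → ∃ c > 0, ∀ y ∈ positiveOrthant N, ‖y - p‖ < δ →
      chiSqDist p (mprk22Map Λ α Δt y)
        ≤ chiSqDist p y - c * ‖scaledGenerator Λ p *ᵥ (y / p)‖ ^ 2 := by
  have hB := isStationaryGenerator_scaledGenerator hoff hΛ hp hp0
  set B := scaledGenerator Λ p
  obtain ⟨δ, hδ, -, c, hc, hdec⟩ := hB.exists_decay
  obtain ⟨ρ, hρ, hρp⟩ : ∃ ρ > 0, ∀ i, ρ ≤ p i := by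
    rcases isEmpty_or_nonempty (Fin N) with hN | hN
    · exact ⟨1, one_pos, fun i => hN.elim i⟩
    · obtain ⟨i, hi⟩ := Finite.exists_min p
      exact ⟨p i, hp i, hi⟩
  obtain ⟨C, hC, hBC⟩ := exists_norm_le_of_ker_le (LinearMap.id (R := ℝ) (M := Fin N → ℝ))
    B.mulVecLin (by rw [LinearMap.ker_id]; exact bot_le)
  simp only [Matrix.mulVecLin_apply, LinearMap.id_apply] at hBC
  refine ⟨δ * ρ, by positivity, fun T hT α hα => ?_⟩
  have hα0 : 0 < α := by linarith
  -- Passing from `B (y2 / p)` to `B (y / p)` costs the factor `1 + α T C`. The rate now depends on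
  -- `T` and `α`, the radius does not.
  refine ⟨c * T / (1 + α * T * C) ^ 2, by positivity, fun y hy hyp => ?_⟩
  obtain ⟨y2, hstep⟩ := isMPRK22Step_mprk22Map hoff hΛ hα hT hy
  have hpos := (step_existsUnique_pos hoff hΛ hα hT hy).2 _ _ hstep
  obtain ⟨h2, h1⟩ := (isMPRK22Step_iff hΛ hy).1 hstep
  have hsum : ∑ i, mprk22Map Λ α T y i = ∑ i, y i := by
    have := dotProduct_mprk22Map hoff hΛ hα hT hy (v := fun _ => 1) hΛ
    simpa [dotProduct] using this
  set y1 := mprk22Map Λ α T y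
  let v : Fin N → ℝ := fun i => patankarWeight α (y i) (y2 i) * y1 i / p i
  have hpne : ∀ i, p i ≠ 0 := fun i => (hp i).ne'
  have hmul : ∀ u : Fin N → ℝ, p * (u / p) = u := fun u => by
    ext i
    simp only [Pi.mul_apply, Pi.div_apply]
    exact mul_div_cancel₀ _ (hpne i)
  have hBv : ∀ i, T * (B *ᵥ v) i = (y1 i - y i) / p i := by
    intro i
    have : p * v = fun ν => patankarWeight α (y ν) (y2 ν) * y1 ν := by
      ext i
      simp only [v, Pi.mul_apply]
      exact mul_div_cancel₀ _ (hpne i)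
    rw [scaledGenerator_mulVec, this, ← mul_div_assoc]
    congr 1
    linarith [h1 i]
  have hx1 : ∀ i, (y / p) i + T * (B *ᵥ v) i = y1 i / p i := by
    intro i
    rw [hBv, Pi.div_apply]
    ring
  have hx2 : ∀ i, (y2 / p) i = (y / p) i + α * T * (B *ᵥ (y2 / p)) i := by
    intro i
    rw [scaledGenerator_mulVec, hmul, Pi.div_apply, Pi.div_apply, h2 i]
    have := h2 i
    ring_nf at this ⊢
  -- The weight is homogeneous of degree zero.
  have hweight : ∀ i, patankarWeight α ((y / p) i) ((y2 / p) i)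
      = patankarWeight α (y i) (y2 i) := by
    intro i
    have hyi := hy i
    have hy2i := hpos.1 i
    have hpi := hp i
    unfold patankarWeight
    simp only [Pi.div_apply]
    rw [Real.div_rpow hy2i.le hpi.le, Real.div_rpow hyi.le hpi.le, Real.rpow_sub hpi,
      Real.rpow_one]
    have h3 : (0 : ℝ) < p i ^ (1 / α) := by positivity
    have h4 : (0 : ℝ) < y i ^ (1 - 1 / α) := by positivity
    have h5 : (0 : ℝ) < y2 i ^ (1 / α) := by positivity
    generalize p i ^ (1 / α) = P at *
    generalize y i ^ (1 - 1 / α) = Y at *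
    generalize y2 i ^ (1 / α) = Z at *
    field_simp
  have hxδ : ∀ i, |(y / p) i - 1| ≤ δ := by
    intro i
    have h3 : |y i - p i| < δ * ρ := (norm_le_pi_norm (y - p) i).trans_lt hyp
    have h4 : (y / p) i - 1 = (y i - p i) / p i := by
      rw [Pi.div_apply, sub_div, div_self (hpne i)]
    rw [h4, abs_div, abs_of_pos (hp i), div_le_iff₀ (hp i)]
    exact h3.le.trans (mul_le_mul_of_nonneg_left (hρp i) hδ.le)
  have hmain := hdec T hT α hα (y / p) (y2 / p) v hxδ hx2
    (fun i => by rw [hx1, hweight]; simp only [v]; ring)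
    (fun i => by rw [hx1]; exact div_pos (hpos.2 i) (hp i))
  -- `(y - p)² / y = p² / y - 2 p + y`, and conservation of mass removes the linear part.
  have hdiff : chiSqDist p y1 - chiSqDist p y
      = ∑ i, p i * (1 / ((y / p) i + T * (B *ᵥ v) i) - 1 / (y / p) i) := by
    have h3 : ∀ i, p i * (1 / ((y / p) i + T * (B *ᵥ v) i) - 1 / (y / p) i)
        = ((y1 i - p i) ^ 2 / y1 i - (y i - p i) ^ 2 / y i) - (y1 i - y i) := by
      intro i
      rw [hx1, Pi.div_apply]
      have := hpne i
      have := (hy i).ne'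
      have := (hpos.2 i).ne'
      field_simp
      ring
    simp only [h3, Finset.sum_sub_distrib, chiSqDist, hsum]
    ring
  have hBx : ‖B *ᵥ (y / p)‖ ≤ (1 + α * T * C) * ‖B *ᵥ (y2 / p)‖ := by
    have h3 : y / p = y2 / p - (α * T) • (B *ᵥ (y2 / p)) := by
      ext i
      rw [Pi.sub_apply, hx2 i]
      simp
    rw [h3, Matrix.mulVec_sub, Matrix.mulVec_smul]
    refine (norm_sub_le _ _).trans ?_
    rw [norm_smul, Real.norm_of_nonneg (by positivity)]
    have := mul_le_mul_of_nonneg_left (hBC (B *ᵥ (y2 / p))) (by positivity : 0 ≤ α * T)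
    linarith
  have hfin : c * T / (1 + α * T * C) ^ 2 * ‖B *ᵥ (y / p)‖ ^ 2
      ≤ c * T * ‖B *ᵥ (y2 / p)‖ ^ 2 := by
    calc _ ≤ c * T / (1 + α * T * C) ^ 2 * ((1 + α * T * C) * ‖B *ᵥ (y2 / p)‖) ^ 2 := by
          gcongr
      _ = _ := by
          have : 1 + α * T * C ≠ 0 := by positivity
          field_simp
  linarith

/-- Lyapunov stability of `p` with a neighbourhood that does not depend on the step size and on
`α`. -/
theorem exists_uniform_stability {N : ℕ} {Λ : Matrix (Fin N) (Fin N) ℝ} {p : Fin N → ℝ}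
    (hoff : ∀ i j, i ≠ j → 0 ≤ Λ i j) (hΛ : IsConservative Λ)
    (hp : p ∈ positiveOrthant N) (hp0 : Λ *ᵥ p = 0) {ε : ℝ} (hε : 0 < ε) :
    ∃ δ > 0, ∀ Δt > 0, ∀ α : ℝ, 1 / 2 ≤ α → ∀ y ∈ positiveOrthant N, ‖y - p‖ < δ →
      ∀ n : ℕ, (mprk22Map Λ α Δt)^[n] y ∈ positiveOrthant N ∧
        ‖(mprk22Map Λ α Δt)^[n] y - p‖ < ε := by
  obtain ⟨δ0, hδ0, hdec⟩ := exists_chiSqDist_decay hoff hΛ hp hp0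
  obtain ⟨η, hη, hηε⟩ := norm_sub_lt_of_chiSqDist_lt hp (lt_min hδ0 hε)
  obtain ⟨δ, hδ, hδη⟩ := chiSqDist_lt_of_norm_sub_lt hp hη
  refine ⟨δ, hδ, fun Δt hΔt α hα y hy hyδ => ?_⟩
  obtain ⟨c, hc, hc'⟩ := hdec Δt hΔt α hα
  have key : ∀ n : ℕ, (mprk22Map Λ α Δt)^[n] y ∈ positiveOrthant N ∧
      chiSqDist p ((mprk22Map Λ α Δt)^[n] y) < η := by
    intro n
    induction n with
    | zero => exact ⟨hy, hδη y hyδ⟩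
    | succ n ih =>
      rw [Function.iterate_succ_apply']
      refine ⟨mprk22Map_mem_positiveOrthant hoff hΛ hα hΔt ih.1, lt_of_le_of_lt ?_ ih.2⟩
      refine (hc' _ ih.1 ((hηε _ ih.1 ih.2).trans_le (min_le_left _ _))).trans ?_
      have := mul_nonneg hc.le
        (sq_nonneg ‖scaledGenerator Λ p *ᵥ ((mprk22Map Λ α Δt)^[n] y / p)‖)
      linarith
  exact fun n => ⟨(key n).1, (hηε _ (key n).1 (key n).2).trans_le (min_le_right _ _)⟩

/-- The orbit started at `p` stays within every `ε` of `p`, so its first iterate is `p`. -/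
theorem mprk22Map_steady {N : ℕ} {Λ : Matrix (Fin N) (Fin N) ℝ} {p : Fin N → ℝ}
    (hoff : ∀ i j, i ≠ j → 0 ≤ Λ i j) (hΛ : IsConservative Λ)
    (hp : p ∈ positiveOrthant N) (hp0 : Λ *ᵥ p = 0) {α Δt : ℝ} (hα : 1 / 2 ≤ α) (hΔt : 0 < Δt) :
    mprk22Map Λ α Δt p = p := by
  rw [← sub_eq_zero, ← norm_le_zero_iff]
  refine le_of_forall_pos_lt_add fun ε hε => ?_
  obtain ⟨δ, hδ, h⟩ := exists_uniform_stability hoff hΛ hp hp0 hε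
  have := (h Δt hΔt α hα p hp (by simpa using hδ) 1).2
  simpa using this

theorem isUnconditionallyStable_mprk22Map {N : ℕ} {Λ : Matrix (Fin N) (Fin N) ℝ}
    (hoff : ∀ i j, i ≠ j → 0 ≤ Λ i j) (hΛ : IsConservative Λ) {α : ℝ} (hα : 1 / 2 ≤ α) :
    IsUnconditionallyStable Λ (mprk22Map Λ α) := by
  refine fun C _ => ⟨C + 1, lt_add_one C, fun Δt hΔt _ p hp hp0 =>
    ⟨mprk22Map_steady hoff hΛ hp hp0 hα hΔt, fun ε hε => ?_⟩⟩
  obtain ⟨δ, hδ, h⟩ := exists_uniform_stability hoff hΛ hp hp0 hε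
  exact ⟨δ, hδ, fun y hy hyδ n => (h Δt hΔt α hα y hy hyδ n).2⟩

/-- On the set of states with vanishing linear invariants the scaled generator is bounded below. -/
theorem exists_norm_le_scaledGenerator {N : ℕ} {Λ : Matrix (Fin N) (Fin N) ℝ} {p : Fin N → ℝ}
    (hoff : ∀ i j, i ≠ j → 0 ≤ Λ i j) (hΛ : IsConservative Λ)
    (hp : p ∈ positiveOrthant N) (hp0 : Λ *ᵥ p = 0) :
    ∃ C > 0, ∀ u : Fin N → ℝ, (∀ v, Λᵀ *ᵥ v = 0 → v ⬝ᵥ (p * u) = 0) →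
      ‖u‖ ≤ C * ‖scaledGenerator Λ p *ᵥ u‖ := by
  have hB := isStationaryGenerator_scaledGenerator hoff hΛ hp hp0
  let W : Submodule ℝ (Fin N → ℝ) :=
    { carrier := {u | ∀ v, Λᵀ *ᵥ v = 0 → v ⬝ᵥ (p * u) = 0}
      add_mem' := fun {a b} ha hb v hv => by
        rw [mul_add, dotProduct_add, ha v hv, hb v hv, add_zero]
      zero_mem' := fun v _ => by rw [mul_zero, dotProduct_zero]
      smul_mem' := fun c a ha v hv => by
        rw [mul_smul_comm, dotProduct_smul, ha v hv, smul_zero] }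
  obtain ⟨C, hC, h⟩ := exists_norm_le_of_ker_le
    ((scaledGenerator Λ p).mulVecLin ∘ₗ W.subtype) W.subtype (by
      intro u hu
      rw [LinearMap.mem_ker, LinearMap.comp_apply, Submodule.subtype_apply,
        Matrix.mulVecLin_apply] at hu
      have hconst : ∀ i j, Λ i j ≠ 0 → (u : Fin N → ℝ) i = (u : Fin N → ℝ) j := by
        intro i j hij
        refine hB.eq_of_mulVec_eq_zero hu ?_
        simp only [scaledGenerator, Matrix.of_apply]
        exact div_ne_zero (mul_ne_zero hij (hp j).ne') (hp i).ne'
      -- A harmonic vector is constant along edges, hence is itself a linear invariant. Pairing it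
      -- with `p * u` gives `∑ p_i u_i² = 0`.
      have hker : Λᵀ *ᵥ (u : Fin N → ℝ) = 0 := by
        ext j
        have h1 : ∀ i, Λ i j * (u : Fin N → ℝ) i = Λ i j * (u : Fin N → ℝ) j := by
          intro i
          by_cases hij : Λ i j = 0
          · simp [hij]
          · rw [hconst i j hij]
        simp only [Matrix.mulVec, dotProduct, Matrix.transpose_apply, h1, ← Finset.sum_mul,
          hΛ.sum_col, zero_mul, Pi.zero_apply]
      have h2 := u.2 u hker
      have h3 := (Finset.sum_eq_zero_iff_of_nonneg (fun i _ => by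
        have := mul_nonneg (hp i).le (mul_self_nonneg ((u : Fin N → ℝ) i))
        simp only [Pi.mul_apply]
        linarith)).1 h2
      rw [LinearMap.mem_ker, Submodule.subtype_apply]
      ext i
      have h4 := h3 i (Finset.mem_univ i)
      simpa [(hp i).ne'] using h4)
  exact ⟨C, hC, fun u hu => h ⟨u, hu⟩⟩

theorem exists_uniform_convergence {N : ℕ} {Λ : Matrix (Fin N) (Fin N) ℝ} {p : Fin N → ℝ}
    (hoff : ∀ i j, i ≠ j → 0 ≤ Λ i j) (hΛ : IsConservative Λ)
    (hp : p ∈ positiveOrthant N) (hp0 : Λ *ᵥ p = 0) :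
    ∃ δ > 0, ∀ y ∈ positiveOrthant N, IsSteadyStateOfIVP Λ y p → ‖y - p‖ < δ →
      ∀ Δt > 0, ∀ α : ℝ, 1 / 2 ≤ α →
        Tendsto (fun n : ℕ => (mprk22Map Λ α Δt)^[n] y) atTop (𝓝 p) := by
  have hB := isStationaryGenerator_scaledGenerator hoff hΛ hp hp0
  obtain ⟨δ0, hδ0, hdec⟩ := exists_chiSqDist_decay hoff hΛ hp hp0
  obtain ⟨δ, hδ, hstab⟩ := exists_uniform_stability hoff hΛ hp hp0 hδ0
  obtain ⟨C, hC, hCB⟩ := exists_norm_le_scaledGenerator hoff hΛ hp hp0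
  refine ⟨δ, hδ, fun y hy hyp hyδ Δt hΔt α hα => ?_⟩
  obtain ⟨c, hc, hc'⟩ := hdec Δt hΔt α hα
  have hn := hstab Δt hΔt α hα y hy hyδ
  set Y : ℕ → Fin N → ℝ := fun n => (mprk22Map Λ α Δt)^[n] y with hY
  have hYs : ∀ n, Y (n + 1) = mprk22Map Λ α Δt (Y n) := fun n =>
    Function.iterate_succ_apply' _ _ _
  have hinv : ∀ v, Λᵀ *ᵥ v = 0 → ∀ n, v ⬝ᵥ Y n = v ⬝ᵥ p := by
    intro v hv n
    induction n with
    | zero => exact (hyp.invariants v hv).symm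
    | succ n ih => rw [hYs, dotProduct_mprk22Map hoff hΛ hα hΔt (hn n).1 hv, ih]
  have hstep : ∀ n, chiSqDist p (Y (n + 1))
      ≤ chiSqDist p (Y n) - c * ‖scaledGenerator Λ p *ᵥ (Y n / p)‖ ^ 2 := by
    intro n
    rw [hYs]
    exact hc' _ (hn n).1 (hn n).2
  have hlim : ∃ l, Tendsto (fun n => chiSqDist p (Y n)) atTop (𝓝 l) := by
    refine ⟨_, tendsto_atTop_ciInf (antitone_nat_of_succ_le fun n => ?_) ⟨0, ?_⟩⟩
    · have := mul_nonneg hc.le (sq_nonneg ‖scaledGenerator Λ p *ᵥ (Y n / p)‖)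
      linarith [hstep n]
    · rintro _ ⟨n, rfl⟩
      exact chiSqDist_nonneg (hn n).1
  obtain ⟨l, hl⟩ := hlim
  -- A monotone sequence bounded below has decrements tending to zero, and these dominate `‖B (Y n /
  -- p)‖²`.
  have hdrop : Tendsto (fun n => (chiSqDist p (Y n) - chiSqDist p (Y (n + 1))) / c) atTop
      (𝓝 0) := by
    have := (hl.sub (hl.comp (tendsto_add_atTop_nat 1))).div_const c
    simpa using this
  have hsq : Tendsto (fun n => ‖scaledGenerator Λ p *ᵥ (Y n / p)‖ ^ 2) atTop (𝓝 0) := by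
    refine squeeze_zero (fun n => sq_nonneg _) (fun n => ?_) hdrop
    rw [le_div_iff₀ hc]
    linarith [hstep n]
  have hBx : Tendsto (fun n => ‖scaledGenerator Λ p *ᵥ (Y n / p)‖) atTop (𝓝 0) := by
    have := hsq.sqrt
    simpa [Real.sqrt_sq (norm_nonneg _)] using this
  have hpne : ∀ i, p i ≠ 0 := fun i => (hp i).ne'
  have hx : Tendsto (fun n => Y n / p - 1) atTop (𝓝 0) := by
    rw [tendsto_zero_iff_norm_tendsto_zero]
    refine squeeze_zero (fun n => norm_nonneg _) (fun n => ?_)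
      (by simpa using hBx.const_mul C)
    refine (hCB (Y n / p - 1) fun v hv => ?_).trans (le_of_eq ?_)
    · have : p * (Y n / p - 1) = Y n - p := by
        ext i
        simp only [Pi.mul_apply, Pi.sub_apply, Pi.div_apply, Pi.one_apply]
        have := hpne i
        field_simp
      rw [this, dotProduct_sub, hinv v hv n, sub_self]
    · rw [Matrix.mulVec_sub, hB.mulVec_one, sub_zero]
  have hfin : Tendsto (fun n => p * (Y n / p - 1) + p) atTop (𝓝 (p * 0 + p)) :=
    (hx.const_mul p).add_const p
  rw [mul_zero, zero_add] at hfin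
  refine hfin.congr fun n => ?_
  ext i
  simp only [Pi.mul_apply, Pi.add_apply, Pi.sub_apply, Pi.div_apply, Pi.one_apply]
  have := hpne i
  field_simp
  ring

theorem mainTheorem7 :
    -- for each conservative test system the scheme is well defined, positive, and
    -- unconditionally stable
    (∀ (α : ℝ), 1 / 2 ≤ α → ∀ (N k : ℕ) (Λ : Matrix (Fin N) (Fin N) ℝ),
      0 < k → IsPositiveLinearSystem Λ k → IsConservative Λ →
        (∀ Δt > 0, ∀ y ∈ positiveOrthant N,
          (∃! x : (Fin N → ℝ) × (Fin N → ℝ), IsMPRK22Step Λ α Δt y x.1 x.2) ∧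
          ∀ y2 y1, IsMPRK22Step Λ α Δt y y2 y1 →
            y2 ∈ positiveOrthant N ∧ y1 ∈ positiveOrthant N) ∧
        IsUnconditionallyStable Λ (mprk22Map Λ α)) ∧
    -- local convergence towards the steady state of the initial value problem
    (∀ (N k : ℕ) (Λ : Matrix (Fin N) (Fin N) ℝ),
      0 < k → IsPositiveLinearSystem Λ k → IsConservative Λ →
        ∀ ystar ∈ positiveOrthant N, Λ *ᵥ ystar = 0 →
          ∃ δ > 0, ∀ y0 ∈ positiveOrthant N, IsSteadyStateOfIVP Λ y0 ystar → ‖y0 - ystar‖ < δ →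
            ∀ Δt > 0, ∀ α : ℝ, 1 / 2 ≤ α →
              Tendsto (fun n : ℕ => (mprk22Map Λ α Δt)^[n] y0) atTop (𝓝 ystar)) ∧
    -- properties of the stability function
    (∀ (α : ℝ), 1 / 2 ≤ α → mprk22StabilityFunction α 0 = 1) ∧
    (∀ (α : ℝ), 1 / 2 < α → ∀ z : ℂ, z.re ≤ 0 → z ≠ 0 → ‖mprk22StabilityFunction α z‖ < 1) ∧
    (∀ z : ℂ, z.re < 0 → ‖mprk22StabilityFunction (1 / 2) z‖ < 1) ∧
    (∀ z : ℂ, z.re = 0 → ‖mprk22StabilityFunction (1 / 2) z‖ = 1) := by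
  refine ⟨fun α hα N k Λ _ hΛ hc => ⟨fun Δt hΔt y hy =>
      step_existsUnique_pos hΛ.metzler hc hα hΔt hy,
      isUnconditionallyStable_mprk22Map hΛ.metzler hc hα⟩,
    fun N k Λ _ hΛ hc ystar hp hp0 => exists_uniform_convergence hΛ.metzler hc hp hp0,
    fun α _ => mprk22StabilityFunction_zero α,
    fun α hα z hz hz0 => norm_mprk22StabilityFunction_lt_one hα hz hz0,
    fun z hz => norm_mprk22StabilityFunction_half_lt_one hz,
    fun z hz => ?_⟩
  exact norm_mprk22StabilityFunction_half_eq_one hz
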